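/- Let $1\le k<d$, let $f:\mathbb R^d\to\mathbb R$ be $C^3$ and let $x^*$ be a point with $\nabla f(x^*)=0$. Write $\|\cdot\|$ for the Euclidean norm and the operator norm, and let $\delta>0$, $0<\mu<L$, $M>0$, $\sigma$, $G_1$ be constants. **Assumptions on $f$.** For all $x,y$ with $\|x-x^*\|,\|y-x^*\|\le\delta$, the eigenvalues of $\nabla^2f(x)$ satisfy $$-L<\lambda_1\le\dots\le\lambda_k<-\mu<0<\mu<\lambda_{k+1}\le\dots\le\lambda_d<L,$$ and $\|\nabla^2f(x)-\nabla^2f(y)\|\le M\|x-y\|$. **Stochastic oracles.** Let $s$ be a random sample from a probability space. The stochastic gradient $g(x,s)$ satisfies $\mathbb E\,g(x,s)=\nabla f(x)$ and $\mathbb E\|g(x,s)-\nabla f(x)\|^2\le\sigma^2$ for all $x\in\mathbb R^d$. The stochastic Hessian $h(x,s)$ (a $d\times d$ matrix) satisfies $\mathbb E\,h(x,s)=\nabla^2f(x)$, $\mathbb E\|h(x,s)\|^2\le\sigma^2$ and $\|h(x,s)\|\le G_1$ almost surely, for $\|x-x^*\|\le\delta$. Both are jointly measurable. **Eigenvector search**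 (tolerance $\epsilon_v>0$, step sizes $\beta(l)>0$ with $\sum\beta(l)=\infty$, $\sum\beta(l)^2<\infty$). At a point $x$, with current vectors $v_1,\dots,v_k$, put $H=\nabla^2f(x)$ and for $j=1,\dots,k$ in turn: replace $v_j$ by $v_j-\sum_{i<j}v_iv_i^\top v_j$ and normalize it; then, for $l=0,1,\dots$, as long as $\|(I-v_jv_j^\top-\sum_{i<j}v_iv_i^\top)Hv_j\|^2\ge L^2\epsilon_v$, replace $v_j$ by $v_j-\beta(l)(I-v_jv_j^\top-\sum_{i<j}v_iv_i^\top)h(x,s)v_j$ with a fresh sample $s$, and normalize it. **Saddle search.** From $x(0)$ and orthonormal $v_1(0),\dots,v_k(0)$, with step sizes $\alpha(n)$, iterate $$x(n+1)=x(n)-\alpha(n)\Big(I-2\sum_{i=1}^kv_i(n)v_i(n)^\top\Big)g(x(n),s_n),$$ and let $(v_i(n+1))_i$ be the output of the eigenvector search at $x(n+1)$ started from $(v_i(n))_i$. All samples, of gradients and of Hessians, are independent and identically distributed. Given $\epsilon_x>0$, the algorithm stops at the first $n$ with $\|\nabla f(x(n))\|^2<L^2\epsilon_x$; below, $(x(n))_{n\ge0}$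 is the infinite sequence obtained without this test. **Constants.** Let $\Delta\in[0,\infty]$ be the infimum of $\lambda_j(x)-\lambda_i(x)$ over $\|x-x^*\|\le\delta$ and $\lambda_i(x)<\lambda_j(x)<0$ ($\Delta=\infty$ if there are no such eigenvalues), and $$Q=\max\Big(1,\frac1{\min(\Delta^2/4,\mu^2)},\frac1{L^2}\Big),\quad \bar z_k=\sqrt{L^{2k}Q^k(k!)^2\epsilon_v/d},\quad \theta=k\bar z_k^2d,\quad c(\theta)=(1-\sqrt\theta)\mu-L\theta-5L\sqrt\theta .$$ Assume that $\epsilon_v>0$ is so small that $\bar z_k<\min(\Delta/2,\mu)$ (which requires $\Delta>0$) and $c(\theta)>0$. Put $r=\min(c(\theta)/M,\delta)$ and $U=\{x:\|x-x^*\|\le r\}$. **Theorem.** There is $\epsilon>0$ with $4\epsilon+2\sqrt\epsilon=r^2$, and $U_0=\{x:\|x-x^*\|\le\sqrt{2\epsilon}\}$ is a nonempty subset of $U$. There is $\gamma_0>0$ such that for every $\gamma\ge\gamma_0$ there are $m_0>0$ and functions $p,C:\mathbb R\to\mathbb R$ with $p(m)\to0$ as $m\to\infty$ and $p(m)<1$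 for $m\ge m_0$, with the following property. Let $m\ge m_0$ and $\alpha(n)=\gamma/(n+m)$. Let oracles, samples and $\beta$ be as above, let $x(0)\in U_0$ and let $v_1(0),\dots,v_k(0)$ be orthonormal. Suppose that, almost surely, whenever the eigenvector search is performed at a point $x(n)\in U$ ($n\ge1$) and stops, its output consists of unstable directions, that is, $v_i(n)^\top\nabla^2f(x(n))v_i(n)<0$ for $i=1,\dots,k$. Let $E^\infty=\{x(n)\in U\text{ for all }n\}$. Then: 1. $\mathbb P(E^\infty)\ge1-p(m)$; 2. conditioned on $E^\infty$, almost surely, every eigenvector search stops after finitely many steps; 3. conditioned on $E^\infty$, almost surely, for every $\epsilon_x>0$ there is an $n$ with $\|\nabla f(x(n))\|^2<L^2\epsilon_x$, so that the algorithm reaches its tolerance in finitely many iterations; 4. $\mathbb E\big(\|x(n)-x^*\|^2\mid E^\infty\big)\le\dfrac{C(m)}{n+m}$ for all $n\ge0$; in particular it is $O(1/n)$. The numbers $\gamma_0,m_0$ and the functions $p,C$ do not depend on the oracles (except through $\sigma$, $G_1$), on the samples, on $\beta$ or on the initial values. -/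

import Mathlib

open MeasureTheory ProbabilityTheory Filter Topology

/-- The Euclidean space `ℝ^d`. -/
abbrev Vec (d : ℕ) : Type := EuclideanSpace ℝ (Fin d)

/-- The Hessian `∇²f(x)`, as the operator `u ↦ D(∇f)(x) u`. -/
noncomputable def hessian {d : ℕ} (f : Vec d → ℝ) (x : Vec d) : Vec d →L[ℝ] Vec d :=
  fderiv ℝ (gradient f) x

/-- The eigenvalues of `A`, listed in increasing order with multiplicity (through an orthonormal
eigenbasis), satisfy `-L < λ₁ ≤ ⋯ ≤ λ_k < -μ` and `μ < λ_{k+1} ≤ ⋯ ≤ λ_d < L`. -/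
def SpectralGap {d : ℕ} (A : Vec d →L[ℝ] Vec d) (k : ℕ) (L μ : ℝ) : Prop :=
  ∃ (b : OrthonormalBasis (Fin d) ℝ (Vec d)) (lam : Fin d → ℝ),
    Monotone lam ∧ (∀ i, A (b i) = lam i • b i) ∧
    (∀ i, -L < lam i ∧ lam i < L) ∧
    (∀ i : Fin d, (i : ℕ) < k → lam i < -μ) ∧
    (∀ i : Fin d, k ≤ (i : ℕ) → μ < lam i)

/-- The local assumption on the Hessian on the closed ball of radius `δ` around `xs`:
spectral gap and Lipschitz continuity. -/
structure HessianAssumption {d : ℕ} (f : Vec d → ℝ) (xs : Vec d) (k : ℕ) (δ L μ M : ℝ) :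
    Prop where
  gap : ∀ x ∈ Metric.closedBall xs δ, SpectralGap (hessian f x) k L μ
  lipschitz : ∀ x ∈ Metric.closedBall xs δ, ∀ y ∈ Metric.closedBall xs δ,
    ‖hessian f x - hessian f y‖ ≤ M * ‖x - y‖

/-- The stochastic gradient `g x s` (with `s` of law `ν`) is unbiased, with variance at most
`σ²`, at every point. -/
structure UnbiasedGradient {d : ℕ} {S : Type*} [MeasurableSpace S] (f : Vec d → ℝ)
    (g : Vec d → S → Vec d) (ν : Measure S) (σ : ℝ) : Prop where
  measurable : Measurable (Function.uncurry g)
  integrable : ∀ x, Integrable (g x) ν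
  mean : ∀ x, ∫ s, g x s ∂ν = gradient f x
  integrable_sq : ∀ x, Integrable (fun s => ‖g x s - gradient f x‖ ^ 2) ν
  variance : ∀ x, ∫ s, ‖g x s - gradient f x‖ ^ 2 ∂ν ≤ σ ^ 2

/-- The stochastic Hessian `h x s` (with `s` of law `ν`) is unbiased, with second moment at most
`σ²` and norm almost surely at most `G₁`, at every point `x` of `B`. It need not be symmetric. -/
structure UnbiasedHessian {d : ℕ} {S : Type*} [MeasurableSpace S] (f : Vec d → ℝ)
    (h : Vec d → S → Vec d →L[ℝ] Vec d) (ν : Measure S) (σ G₁ : ℝ) (B : Set (Vec d)) :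
    Prop where
  measurable : Measurable (Function.uncurry h)
  bounded : ∀ x ∈ B, ∀ᵐ s ∂ν, ‖h x s‖ ≤ G₁
  mean : ∀ x ∈ B, ∫ s, h x s ∂ν = hessian f x
  second_moment : ∀ x ∈ B, ∫ s, ‖h x s‖ ^ 2 ∂ν ≤ σ ^ 2

/-- Positive step sizes with divergent sum and convergent sum of squares. -/
structure DecayStepSize (a : ℕ → ℝ) : Prop where
  pos : ∀ n, 0 < a n
  not_summable : ¬ Summable a
  summable_sq : Summable fun n => a n ^ 2

/-! ### The eigenvector search -/

/-- `∑_{i<j} v_i v_iᵀ u`. -/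
noncomputable def prevProj {d k : ℕ} (v : Fin k → Vec d) (j : Fin k) (u : Vec d) : Vec d :=
  ∑ i ∈ Finset.Iio j, inner ℝ (v i) u • v i

/-- `(I - u uᵀ - ∑_{i<j} v_i v_iᵀ) A u`. -/
noncomputable def searchField {d k : ℕ} (A : Vec d →L[ℝ] Vec d) (v : Fin k → Vec d) (j : Fin k)
    (u : Vec d) : Vec d :=
  A u - inner ℝ u (A u) • u - prevProj v j (A u)

/-- The iterates of the search for the `j`-th direction, with sampled Hessians `A 0, A 1, …` and
step sizes `β`. The start is `v_j`, made orthogonal to `v_i`, `i < j`, and normalized. -/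
noncomputable def searchIter {d k : ℕ} (A : ℕ → Vec d →L[ℝ] Vec d) (β : ℕ → ℝ)
    (v : Fin k → Vec d) (j : Fin k) : ℕ → Vec d
  | 0 => NormedSpace.normalize (v j - prevProj v j (v j))
  | l + 1 =>
    NormedSpace.normalize
      (searchIter A β v j l - β l • searchField (A l) v j (searchIter A β v j l))

/-- The numbers of inner steps at which the stopping test
`‖(I - u uᵀ - ∑_{i<j} v_i v_iᵀ) H u‖² < tol` of the search for the `j`-th direction succeeds.
The test uses the exact matrix `H`, the iteration the samples `A`. -/
def stopTimes {d k : ℕ} (H : Vec d →L[ℝ] Vec d) (tol : ℝ) (A : ℕ → Vec d →L[ℝ] Vec d)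
    (β : ℕ → ℝ) (v : Fin k → Vec d) (j : Fin k) : Set ℕ :=
  {l | ‖searchField H v j (searchIter A β v j l)‖ ^ 2 < tol}

/-- The current vectors after the directions with index `< j` have been processed, in this order,
each one replaced by the iterate at the first success of the stopping test. (If a test never
succeeds, the value is irrelevant; see `SearchStops`.) -/
noncomputable def searchUpTo {d k : ℕ} (H : Vec d →L[ℝ] Vec d) (tol : ℝ)
    (A : Fin k → ℕ → Vec d →L[ℝ] Vec d) (β : ℕ → ℝ) (v : Fin k → Vec d) :
    ℕ → Fin k → Vec d
  | 0 => v
  | j + 1 =>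
    if hj : j < k then
      Function.update (searchUpTo H tol A β v j) ⟨j, hj⟩
        (searchIter (A ⟨j, hj⟩) β (searchUpTo H tol A β v j) ⟨j, hj⟩
          (sInf (stopTimes H tol (A ⟨j, hj⟩) β (searchUpTo H tol A β v j) ⟨j, hj⟩)))
    else searchUpTo H tol A β v j

/-- The output of the eigenvector search for `k` directions, started from `v`. -/
noncomputable def eigenSearch {d k : ℕ} (H : Vec d →L[ℝ] Vec d) (tol : ℝ)
    (A : Fin k → ℕ → Vec d →L[ℝ] Vec d) (β : ℕ → ℝ) (v : Fin k → Vec d) : Fin k → Vec d :=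
  searchUpTo H tol A β v k

/-- Each of the `k` loops of the eigenvector search stops after finitely many steps. -/
def SearchStops {d k : ℕ} (H : Vec d →L[ℝ] Vec d) (tol : ℝ)
    (A : Fin k → ℕ → Vec d →L[ℝ] Vec d) (β : ℕ → ℝ) (v : Fin k → Vec d) : Prop :=
  ∀ j : Fin k, (stopTimes H tol (A j) β (searchUpTo H tol A β v j) j).Nonempty

/-! ### The saddle search -/

/-- Indices of the samples: `inl n` for the stochastic gradient of step `n`, and `inr (n, j, l)`
for the stochastic Hessian in inner step `l` of the search for direction `j` that follows the
`n`-th update of `x`. -/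
abbrev SampleIdx (k : ℕ) : Type := ℕ ⊕ (ℕ × Fin k × ℕ)

/-- The data of the saddle-search algorithm: objective `f`, stochastic gradient `g`, stochastic
Hessian `h`, tolerance `tol` of the eigenvector search, step sizes `α` of the saddle search and
`β` of the eigenvector search. -/
structure SaddleSearch (d : ℕ) (S : Type*) where
  f : Vec d → ℝ
  g : Vec d → S → Vec d
  h : Vec d → S → Vec d →L[ℝ] Vec d
  tol : ℝ
  α : ℕ → ℝ
  β : ℕ → ℝ

namespace SaddleSearch

variable {d k : ℕ} {S : Type*}

/-- `(I - 2 ∑ v_i v_iᵀ) u`. -/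
noncomputable def reflect (v : Fin k → Vec d) (u : Vec d) : Vec d :=
  u - (2 : ℝ) • ∑ i, inner ℝ (v i) u • v i

/-- The Hessian samples used by the `n`-th eigenvector search, performed at the point `x`. -/
def hessSamples (a : SaddleSearch d S) (z : SampleIdx k → S) (n : ℕ) (x : Vec d) :
    Fin k → ℕ → Vec d →L[ℝ] Vec d :=
  fun j l => a.h x (z (Sum.inr (n, j, l)))

/-- The iterates `(x(n), (v_i(n))_i)` of the saddle search with initial values `x₀`, `v₀` and
samples `z`. The outer stopping test is not built in, so the sequence is infinite; the algorithm
with the test stops at the first `n` with `‖∇f(x(n))‖² < L² ε_x`. -/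
noncomputable def run (a : SaddleSearch d S) (x₀ : Vec d) (v₀ : Fin k → Vec d)
    (z : SampleIdx k → S) : ℕ → Vec d × (Fin k → Vec d)
  | 0 => (x₀, v₀)
  | n + 1 =>
    let p := run a x₀ v₀ z n
    let x' := p.1 - a.α n • reflect p.2 (a.g p.1 (z (Sum.inl n)))
    (x', eigenSearch (hessian a.f x') a.tol (a.hessSamples z n x') a.β p.2)

/-- The `n`-th eigenvector search (performed at `x(n+1)`, started from `v(n)`) stops. -/
def StopsAt (a : SaddleSearch d S) (x₀ : Vec d) (v₀ : Fin k → Vec d)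
    (z : SampleIdx k → S) (n : ℕ) : Prop :=
  SearchStops (hessian a.f (a.run x₀ v₀ z (n + 1)).1) a.tol
    (a.hessSamples z n (a.run x₀ v₀ z (n + 1)).1) a.β (a.run x₀ v₀ z n).2

/-- Whenever the eigenvector search is performed at a point of `U` and stops, its output consists
of unstable directions, `v_iᵀ ∇²f(x) v_i < 0`. -/
def FindsUnstable (a : SaddleSearch d S) (x₀ : Vec d) (v₀ : Fin k → Vec d)
    (z : SampleIdx k → S) (U : Set (Vec d)) : Prop :=
  ∀ n, (a.run x₀ v₀ z (n + 1)).1 ∈ U → a.StopsAt x₀ v₀ z n →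
    ∀ i, inner ℝ ((a.run x₀ v₀ z (n + 1)).2 i)
      (hessian a.f (a.run x₀ v₀ z (n + 1)).1 ((a.run x₀ v₀ z (n + 1)).2 i)) < 0

end SaddleSearch

/-! ### The constants -/

/-- `Δ`: the infimum of the gaps between distinct negative eigenvalues of `∇²f(x)` over the closed
ball of radius `δ` around `xs` (`∞` if there are no two distinct negative eigenvalues). -/
noncomputable def negGap {d : ℕ} (f : Vec d → ℝ) (xs : Vec d) (δ : ℝ) : ENNReal :=
  ⨅ x ∈ Metric.closedBall xs δ, ⨅ (a : ℝ) (b : ℝ)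
    (_ : Module.End.HasEigenvalue (hessian f x : Vec d →ₗ[ℝ] Vec d) a ∧
      Module.End.HasEigenvalue (hessian f x : Vec d →ₗ[ℝ] Vec d) b ∧ a < b ∧ b < 0),
    ENNReal.ofReal (b - a)

/-- `Q = max(1, 1 / min(Δ²/4, μ²), 1/L²)`, for `Δ > 0`. -/
noncomputable def constQ (Δ : ENNReal) (L μ : ℝ) : ℝ :=
  max 1 (max (1 / (min (Δ ^ 2 / 4) (ENNReal.ofReal μ ^ 2)).toReal) (1 / L ^ 2))

/-- `z̄_k = √(L^{2k} Q^k (k!)² ε_v / d)`. -/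
noncomputable def zbar (d k : ℕ) (L Q εv : ℝ) : ℝ :=
  √(L ^ (2 * k) * Q ^ k * (k.factorial : ℝ) ^ 2 * εv / d)

/-- `(1 - √θ) μ - L θ - 5 L √θ`. -/
noncomputable def descentConst (L μ θ : ℝ) : ℝ :=
  (1 - √θ) * μ - L * θ - 5 * L * √θ

/-- The radius of the attraction domain `U`. -/
noncomputable def attractionRadius (L μ M δ θ : ℝ) : ℝ :=
  min (descentConst L μ θ / M) δ

/-! Three facts carry the theorem.

Deterministic coercivity. If the stopped search returns orthonormal `v_j` with small residuals and
negative Rayleigh quotients, then a stable eigenvalue is at distance more than `μ` from each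
quotient, so the `v_j` have total squared mass at most `k² tol / μ² ≤ θ` on the stable eigenvectors.
The projection onto their span and the spectral projection onto the `k` unstable eigenvectors both
have rank `k`, so they differ by at most `2√θ` in norm, and the reflected Hessian is coercive with
constant `μ - 4L√θ` (`SpectralGap.le_inner_reflect`). The Taylor remainder of the gradient costs at
most `c(θ)` inside `U`; what is left is `κ = μ√θ + Lθ + L√θ > 0`. In `U`, reflected gradient descent
therefore contracts towards `x*` on average.

Termination of the search. One inner step lowers the Rayleigh quotient in expectation by `2β` times
the squared residual, up to a noise term of order `β²`. The quotient is bounded, `∑ β = ∞` and `∑ β²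
< ∞`, so the residual cannot stay above the tolerance with positive probability
(`ae_stopTimes_nonempty`).

Staying in `U`, and the rate. The squared distance to the smaller ball `U₀` grows in expectation by
at most `α(n)² G` per step while the path is in `U`, and leaving `U` costs at least `(r - ρ)²`. This
bounds the escape probability by a multiple of `∑ α(n)²`, which is `O(1/m)`
(`measure_compl_stayUpTo_le`). On the event of staying, `E‖x(n) - x*‖²` satisfies the recursion of
step sizes `γ/(n+m)` with `2κγ ≥ 2`, whose solution is `O(1/(n+m))` (`setLIntegral_sq_le`).

The initial frame need not be close to the unstable eigenvectors, so no descent is available in step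
`0`. The escape bound does not need it, because `x(0)` lies in `U₀` and its distance to `U₀`
vanishes; the rate starts its recursion at `n = 1`.

All expectations are integrals in `[0,∞]` over the event of having stayed so far, and a fresh sample
is integrated out by Fubini; conditional expectations do not occur. -/

/-! ### Families of pairwise orthogonal vectors of norm zero or one -/

/-- The vectors `e i`, `i ∈ s`, are pairwise orthogonal and each one is zero or a unit vector. -/
structure SubOrthonormal {ι V : Type*} [NormedAddCommGroup V] [InnerProductSpace ℝ V]
    (s : Finset ι) (e : ι → V) : Prop where
  norm : ∀ i ∈ s, e i = 0 ∨ ‖e i‖ = 1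
  orth : ∀ i ∈ s, ∀ j ∈ s, i ≠ j → inner ℝ (e i) (e j) = 0

section SubOrthonormal

variable {ι V : Type*} [NormedAddCommGroup V] [InnerProductSpace ℝ V] {s : Finset ι} {e : ι → V}

theorem Orthonormal.subOrthonormal (he : Orthonormal ℝ e) (s : Finset ι) : SubOrthonormal s e :=
  ⟨fun i _ => Or.inr (he.1 i), fun _ _ _ _ hij => he.2 hij⟩

namespace SubOrthonormal

theorem inner_sum_proj (he : SubOrthonormal s e) {i : ι} (hi : i ∈ s) (y : V) :
    inner ℝ (e i) (∑ j ∈ s, inner ℝ (e j) y • e j) = inner ℝ (e i) y := by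
  rw [inner_sum, Finset.sum_eq_single i]
  · rw [inner_smul_right, real_inner_self_eq_norm_sq]
    rcases he.norm i hi with h | h
    · simp [h]
    · simp [h]
  · intro j hj hji
    rw [inner_smul_right, he.orth i hi j hj hji.symm, mul_zero]
  · exact fun h => absurd hi h

theorem inner_proj_self (he : SubOrthonormal s e) (y : V) :
    inner ℝ (∑ j ∈ s, inner ℝ (e j) y • e j) y = ‖∑ j ∈ s, inner ℝ (e j) y • e j‖ ^ 2 := by
  rw [← real_inner_self_eq_norm_sq]
  simp only [sum_inner, real_inner_smul_left]
  exact Finset.sum_congr rfl fun i hi => by rw [he.inner_sum_proj hi]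

theorem norm_proj_sq (he : SubOrthonormal s e) (y : V) :
    ‖∑ j ∈ s, inner ℝ (e j) y • e j‖ ^ 2 = ∑ j ∈ s, inner ℝ (e j) y ^ 2 := by
  rw [← he.inner_proj_self]
  simp only [sum_inner, real_inner_smul_left, sq]

end SubOrthonormal

end SubOrthonormal

/-! ### The reflection is symmetric and norm preserving. -/

namespace SaddleSearch

variable {d k : ℕ}

theorem inner_reflect (v : Fin k → Vec d) (x y : Vec d) :
    inner ℝ x (reflect v y) = inner ℝ (reflect v x) y := by
  simp only [reflect, inner_sub_left, inner_sub_right, real_inner_smul_left, inner_smul_right,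
    inner_sum, sum_inner]
  congr 2
  refine Finset.sum_congr rfl fun i _ => ?_
  rw [real_inner_comm x (v i)]
  ring

theorem norm_reflect {v : Fin k → Vec d} (hv : SubOrthonormal Finset.univ v) (y : Vec d) :
    ‖reflect v y‖ = ‖y‖ := by
  have h : ‖reflect v y‖ ^ 2 = ‖y‖ ^ 2 := by
    rw [reflect, norm_sub_sq_real, inner_smul_right, real_inner_comm, hv.inner_proj_self,
      norm_smul, mul_pow]
    norm_num
    ring
  exact (sq_eq_sq₀ (norm_nonneg _) (norm_nonneg _)).1 h

end SaddleSearch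

/-! ### Invariants of the eigenvector search -/

section Search

variable {d k : ℕ}

theorem normalize_eq_zero_or {V : Type*} [NormedAddCommGroup V] [NormedSpace ℝ V] (x : V) :
    NormedSpace.normalize x = 0 ∨ ‖NormedSpace.normalize x‖ = 1 := by
  by_cases hx : x = 0
  · left
    simp [hx, NormedSpace.normalize]
  · exact Or.inr (NormedSpace.norm_normalize hx)

theorem inner_normalize_eq_zero {V : Type*} [NormedAddCommGroup V] [InnerProductSpace ℝ V]
    {x y : V} (h : inner ℝ x y = 0) : inner ℝ x (NormedSpace.normalize y) = 0 := by
  rw [NormedSpace.normalize, inner_smul_right, h, mul_zero]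

theorem inner_prevProj {v : Fin k → Vec d} {j : Fin k} (hv : SubOrthonormal (Finset.Iio j) v)
    {i : Fin k} (hi : i < j) (y : Vec d) : inner ℝ (v i) (prevProj v j y) = inner ℝ (v i) y :=
  hv.inner_sum_proj (Finset.mem_Iio.2 hi) y

theorem inner_searchField {v : Fin k → Vec d} {j : Fin k}
    (hv : SubOrthonormal (Finset.Iio j) v) (A : Vec d →L[ℝ] Vec d) {u : Vec d}
    (hu : ∀ i < j, inner ℝ (v i) u = 0) {i : Fin k} (hi : i < j) :
    inner ℝ (v i) (searchField A v j u) = 0 := by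
  rw [searchField, inner_sub_right, inner_sub_right, inner_prevProj hv hi, inner_smul_right,
    hu i hi]
  ring

theorem inner_prevProj_eq_zero {v : Fin k → Vec d} {j : Fin k} {x : Vec d}
    (hx : ∀ i < j, inner ℝ (v i) x = 0) (y : Vec d) : inner ℝ x (prevProj v j y) = 0 := by
  rw [prevProj, inner_sum]
  refine Finset.sum_eq_zero fun i hi => ?_
  rw [inner_smul_right, real_inner_comm (v i) x, hx i (Finset.mem_Iio.1 hi), mul_zero]

theorem inner_self_searchField {v : Fin k → Vec d} {j : Fin k} (A : Vec d →L[ℝ] Vec d)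
    {u : Vec d} (hu : ∀ i < j, inner ℝ (v i) u = 0) (hu1 : u = 0 ∨ ‖u‖ = 1) :
    inner ℝ u (searchField A v j u) = 0 := by
  rw [searchField, inner_sub_right, inner_sub_right, inner_prevProj_eq_zero hu, inner_smul_right,
    real_inner_self_eq_norm_sq]
  rcases hu1 with h | h
  · simp [h]
  · simp [h]

/-- The field is `A u` minus its components along `u` and the earlier `v_i`, and it is orthogonal to
all of these. No symmetry of `A` is needed, so the identity also serves for sampled Hessians. -/
theorem inner_searchField_apply {v : Fin k → Vec d} {j : Fin k}
    (hv : SubOrthonormal (Finset.Iio j) v) (A : Vec d →L[ℝ] Vec d) {u : Vec d}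
    (hu : ∀ i < j, inner ℝ (v i) u = 0) (hu1 : u = 0 ∨ ‖u‖ = 1) :
    inner ℝ (searchField A v j u) (A u) = ‖searchField A v j u‖ ^ 2 := by
  have h : A u = searchField A v j u + inner ℝ u (A u) • u + prevProj v j (A u) := by
    rw [searchField]
    abel
  conv_lhs => rw [h]
  rw [inner_add_right, inner_add_right, inner_smul_right,
    real_inner_comm u, inner_self_searchField A hu hu1,
    inner_prevProj_eq_zero (fun i hi => inner_searchField hv A hu hi), real_inner_self_eq_norm_sq]
  ring

theorem norm_searchField_le {v : Fin k → Vec d} {j : Fin k}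
    (hv : SubOrthonormal (Finset.Iio j) v) (A : Vec d →L[ℝ] Vec d) {u : Vec d}
    (hu : ∀ i < j, inner ℝ (v i) u = 0) (hu1 : u = 0 ∨ ‖u‖ = 1) :
    ‖searchField A v j u‖ ≤ ‖A‖ := by
  have h1 : ‖A u‖ ≤ ‖A‖ := by
    refine (A.le_opNorm u).trans ?_
    have : ‖u‖ ≤ 1 := by rcases hu1 with h | h <;> simp [h]
    exact mul_le_of_le_one_right (norm_nonneg _) this
  have h2 := real_inner_le_norm (searchField A v j u) (A u)
  rw [inner_searchField_apply hv A hu hu1, sq] at h2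
  rcases (norm_nonneg (searchField A v j u)).eq_or_lt with h | h
  · rw [← h]
    exact norm_nonneg _
  · exact (le_of_mul_le_mul_left h2 h).trans h1

/-- The correction is orthogonal to the earlier vectors whatever the sample is. The value `0` has to
be allowed because `NormedSpace.normalize 0 = 0`. -/
theorem searchIter_invariant {v : Fin k → Vec d} {j : Fin k}
    (hv : SubOrthonormal (Finset.Iio j) v) (A : ℕ → Vec d →L[ℝ] Vec d) (β : ℕ → ℝ) (l : ℕ) :
    (searchIter A β v j l = 0 ∨ ‖searchIter A β v j l‖ = 1) ∧
      ∀ i < j, inner ℝ (v i) (searchIter A β v j l) = 0 := by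
  induction l with
  | zero =>
    refine ⟨normalize_eq_zero_or _, fun i hi => inner_normalize_eq_zero ?_⟩
    rw [inner_sub_right, inner_prevProj hv hi, sub_self]
  | succ l ih =>
    refine ⟨normalize_eq_zero_or _, fun i hi => inner_normalize_eq_zero ?_⟩
    rw [inner_sub_right, inner_smul_right, inner_searchField hv (A l) ih.2 hi, ih.2 i hi]
    ring

theorem prevProj_congr {v w : Fin k → Vec d} {j : Fin k} (h : ∀ i < j, v i = w i) :
    prevProj v j = prevProj w j := by
  funext u
  exact Finset.sum_congr rfl fun i hi => by rw [h i (Finset.mem_Iio.1 hi)]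

theorem searchField_congr {v w : Fin k → Vec d} {j : Fin k} (h : ∀ i < j, v i = w i)
    (A : Vec d →L[ℝ] Vec d) (u : Vec d) : searchField A v j u = searchField A w j u := by
  rw [searchField, searchField, prevProj_congr h]

theorem searchUpTo_succ_of_ne (H : Vec d →L[ℝ] Vec d) (tol : ℝ)
    (A : Fin k → ℕ → Vec d →L[ℝ] Vec d) (β : ℕ → ℝ) (v : Fin k → Vec d) (j : ℕ) (i : Fin k)
    (hij : (i : ℕ) ≠ j) :
    searchUpTo H tol A β v (j + 1) i = searchUpTo H tol A β v j i := by
  rw [searchUpTo]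
  split_ifs with hj
  · refine Function.update_of_ne ?_ _ _
    rintro rfl
    exact hij rfl
  · rfl

theorem searchUpTo_eq_of_le (H : Vec d →L[ℝ] Vec d) (tol : ℝ)
    (A : Fin k → ℕ → Vec d →L[ℝ] Vec d) (β : ℕ → ℝ) (v : Fin k → Vec d) {j j' : ℕ} (i : Fin k)
    (hij : (i : ℕ) < j) (hj : j ≤ j') :
    searchUpTo H tol A β v j' i = searchUpTo H tol A β v j i := by
  induction j', hj using Nat.le_induction with
  | base => rfl
  | succ m hm ih => rw [searchUpTo_succ_of_ne _ _ _ _ _ _ _ (by omega), ih]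

theorem searchUpTo_self (H : Vec d →L[ℝ] Vec d) (tol : ℝ)
    (A : Fin k → ℕ → Vec d →L[ℝ] Vec d) (β : ℕ → ℝ) (v : Fin k → Vec d) (j : Fin k) :
    searchUpTo H tol A β v (j + 1) j = searchIter (A j) β (searchUpTo H tol A β v j) j
      (sInf (stopTimes H tol (A j) β (searchUpTo H tol A β v j) j)) := by
  rw [searchUpTo, dif_pos j.2]
  exact Function.update_self _ _ _

/-- This holds on every path: even if a loop never stops, the default index `sInf ∅ = 0` selects one
of its iterates. Hence the reflections preserve norms surely, and not only after a successful
search. -/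
theorem subOrthonormal_searchUpTo (H : Vec d →L[ℝ] Vec d) (tol : ℝ)
    (A : Fin k → ℕ → Vec d →L[ℝ] Vec d) (β : ℕ → ℝ) (v : Fin k → Vec d) (j : ℕ) :
    SubOrthonormal (Finset.univ.filter fun i : Fin k => (i : ℕ) < j)
      (searchUpTo H tol A β v j) := by
  induction j with
  | zero => exact ⟨by simp, by simp⟩
  | succ j ih =>
    by_cases hj : j < k
    · set J : Fin k := ⟨j, hj⟩ with hJ
      have hs : (Finset.univ.filter fun i : Fin k => (i : ℕ) < j) = Finset.Iio J := by
        ext i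
        simp [hJ, Fin.lt_def]
      rw [hs] at ih
      have inv := searchIter_invariant ih (A J) β
        (sInf (stopTimes H tol (A J) β (searchUpTo H tol A β v j) J))
      have hself : searchUpTo H tol A β v (j + 1) J = _ := searchUpTo_self H tol A β v J
      have hlt : ∀ i : Fin k, (i : ℕ) < j →
          searchUpTo H tol A β v (j + 1) i = searchUpTo H tol A β v j i := fun i hi =>
        searchUpTo_succ_of_ne _ _ _ _ _ _ _ hi.ne
      have hcase : ∀ i : Fin k, (i : ℕ) < j + 1 → (i : ℕ) < j ∨ i = J := by
        intro i hi
        rcases Nat.lt_succ_iff_lt_or_eq.1 hi with h | h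
        · exact Or.inl h
        · exact Or.inr (Fin.ext h)
      have hmem : ∀ i : Fin k, (i : ℕ) < j → i ∈ Finset.Iio J := fun i hi => by
        simpa [hJ, Fin.lt_def] using hi
      constructor
      · intro i hi
        rcases hcase i (by simpa using hi) with h | rfl
        · rw [hlt i h]
          exact ih.norm i (hmem i h)
        · rw [hself]
          exact inv.1
      · intro i hi i' hi' hne
        rcases hcase i (by simpa using hi) with h | rfl <;>
          rcases hcase i' (by simpa using hi') with h' | rfl
        · rw [hlt i h, hlt i' h']
          exact ih.orth i (hmem i h) i' (hmem i' h') hne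
        · rw [hlt i h, hself]
          exact inv.2 i (Finset.mem_Iio.1 (hmem i h))
        · rw [hlt i' h', hself, real_inner_comm]
          exact inv.2 i' (Finset.mem_Iio.1 (hmem i' h'))
        · exact absurd rfl hne
    · have : searchUpTo H tol A β v (j + 1) = searchUpTo H tol A β v j := by
        rw [searchUpTo, dif_neg hj]
      rw [this]
      have h1 : (Finset.univ.filter fun i : Fin k => (i : ℕ) < j + 1) =
          Finset.univ.filter fun i : Fin k => (i : ℕ) < j := by
        ext i
        have := i.2
        simp only [Finset.mem_filter, Finset.mem_univ, true_and]
        omega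
      rwa [h1]

theorem subOrthonormal_Iio_searchUpTo (H : Vec d →L[ℝ] Vec d) (tol : ℝ)
    (A : Fin k → ℕ → Vec d →L[ℝ] Vec d) (β : ℕ → ℝ) (v : Fin k → Vec d) (j : Fin k) :
    SubOrthonormal (Finset.Iio j) (searchUpTo H tol A β v j) := by
  convert subOrthonormal_searchUpTo H tol A β v j
  ext i
  simp

theorem subOrthonormal_eigenSearch (H : Vec d →L[ℝ] Vec d) (tol : ℝ)
    (A : Fin k → ℕ → Vec d →L[ℝ] Vec d) (β : ℕ → ℝ) (v : Fin k → Vec d) :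
    SubOrthonormal Finset.univ (eigenSearch H tol A β v) := by
  rw [eigenSearch]
  convert subOrthonormal_searchUpTo H tol A β v k
  ext i
  simp

/-- The test for direction `j` involves only `v_i` with `i ≤ j`, and these are not changed by the
later loops, so it still holds for the final output. -/
theorem SearchStops.norm_searchField_eigenSearch {H : Vec d →L[ℝ] Vec d} {tol : ℝ}
    {A : Fin k → ℕ → Vec d →L[ℝ] Vec d} {β : ℕ → ℝ} {v : Fin k → Vec d}
    (hs : SearchStops H tol A β v) (j : Fin k) :
    ‖searchField H (eigenSearch H tol A β v) j (eigenSearch H tol A β v j)‖ ^ 2 < tol := by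
  have h1 : eigenSearch H tol A β v j = _ :=
    (searchUpTo_eq_of_le H tol A β v j (Nat.lt_succ_self j) j.2).trans
      (searchUpTo_self H tol A β v j)
  have h2 : ∀ i < j, eigenSearch H tol A β v i = searchUpTo H tol A β v j i := fun i hi =>
    searchUpTo_eq_of_le H tol A β v i hi j.2.le
  rw [searchField_congr h2, h1]
  exact Nat.sInf_mem (hs j)

end Search

/-! ### Approximate eigenvectors and the reflected Hessian -/

section Spectral

variable {d k : ℕ} {A : Vec d →L[ℝ] Vec d} {L μ : ℝ}

theorem SpectralGap.symmetric (hA : SpectralGap A k L μ) (x y : Vec d) :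
    inner ℝ (A x) y = inner ℝ x (A y) := by
  obtain ⟨b, lam, -, hb, -⟩ := hA
  have key : ∀ x i, inner ℝ (b i) (A x) = lam i * inner ℝ (b i) x := by
    intro x i
    conv_lhs => rw [← b.sum_repr' x]
    simp only [map_sum, map_smul, hb, inner_sum, inner_smul_right]
    rw [Finset.sum_eq_single i]
    · rw [real_inner_self_eq_norm_sq, b.orthonormal.1 i]
      ring
    · intro j _ hj
      rw [b.orthonormal.2 hj.symm]
      ring
    · simp
  rw [← b.sum_inner_mul_inner (A x) y, ← b.sum_inner_mul_inner x (A y)]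
  refine Finset.sum_congr rfl fun i _ => ?_
  rw [key, real_inner_comm, key, real_inner_comm (b i) x]
  ring

theorem SpectralGap.norm_le (hA : SpectralGap A k L μ) (hL : 0 ≤ L) : ‖A‖ ≤ L := by
  have hs := hA.symmetric
  obtain ⟨b, lam, -, hb, hl, -⟩ := hA
  refine A.opNorm_le_bound hL fun x => ?_
  have h : ‖A x‖ ^ 2 ≤ (L * ‖x‖) ^ 2 := by
    rw [mul_pow, ← b.sum_sq_norm_inner_right (A x), ← b.sum_sq_norm_inner_right x, Finset.mul_sum]
    refine Finset.sum_le_sum fun i _ => ?_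
    rw [← hs, hb, real_inner_smul_left, norm_mul, mul_pow]
    refine mul_le_mul_of_nonneg_right ?_ (sq_nonneg _)
    rw [Real.norm_eq_abs, sq_abs]
    exact sq_le_sq' (hl i).1.le (hl i).2.le
  exact le_of_sq_le_sq h (by positivity)

/-- Squared deviation of `v j` from being an eigenvector. -/
theorem norm_residual_le (hA : ∀ x y, inner ℝ (A x) y = inner ℝ x (A y)) {v : Fin k → Vec d}
    (hv : Orthonormal ℝ v) {tol : ℝ} (hr : ∀ j, ‖searchField A v j (v j)‖ ^ 2 ≤ tol) (j : Fin k) :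
    ‖A (v j) - inner ℝ (v j) (A (v j)) • v j‖ ^ 2 ≤ k * tol := by
  have horth : ∀ i < j, inner ℝ (v i) (v j) = 0 := fun i hi => hv.2 hi.ne
  have hsub := hv.subOrthonormal (Finset.Iio j)
  have h1 : A (v j) - inner ℝ (v j) (A (v j)) • v j =
      searchField A v j (v j) + prevProj v j (A (v j)) := by
    rw [searchField]
    abel
  -- By symmetry, the component of `A v_j` along an earlier `v_i` is the component of `A v_i` along
  -- `v_j`. As `v_j` is orthogonal to all that the field at `v_i` subtracts, it is a component of
  -- the `i`-th residual.
  have h2 : ‖prevProj v j (A (v j))‖ ^ 2 ≤ j * tol := by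
    rw [prevProj, hsub.norm_proj_sq]
    calc ∑ i ∈ Finset.Iio j, inner ℝ (v i) (A (v j)) ^ 2 ≤ ∑ i ∈ Finset.Iio j, tol := by
          refine Finset.sum_le_sum fun i hi => ?_
          have hij := Finset.mem_Iio.1 hi
          have h3 : inner ℝ (v i) (A (v j)) = inner ℝ (v j) (searchField A v i (v i)) := by
            rw [searchField, inner_sub_right, inner_sub_right, inner_smul_right, hv.2 hij.ne',
              inner_prevProj_eq_zero (fun l hl => hv.2 (hl.trans hij).ne), ← hA, real_inner_comm]
            ring
          rw [h3]
          refine le_trans ?_ (hr i)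
          have := abs_real_inner_le_norm (v j) (searchField A v i (v i))
          rw [hv.1 j, one_mul] at this
          rw [← sq_abs]
          exact pow_le_pow_left₀ (abs_nonneg _) this 2
      _ = j * tol := by simp
  have htol : 0 ≤ tol := (sq_nonneg _).trans (hr j)
  rw [h1, norm_add_sq_real, inner_prevProj_eq_zero
    (fun i hi => inner_searchField hsub A horth hi)]
  have hjk : (j : ℝ) + 1 ≤ k := by exact_mod_cast j.2
  nlinarith [hr j, h2, mul_le_mul_of_nonneg_right hjk htol]

/-- In the eigenbasis the residual of `v_j` has coordinates `(λ_i - a) ⟨b_i, v_j⟩`, where `a < 0` is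
the Rayleigh quotient. For stable `i` the factor exceeds `μ`, which turns a small residual into
small stable mass. -/
theorem SpectralGap.sum_inner_stable_le (hA : SpectralGap A k L μ) (hμ : 0 < μ)
    {v : Fin k → Vec d} (hv : Orthonormal ℝ v) {tol : ℝ}
    (hr : ∀ j, ‖searchField A v j (v j)‖ ^ 2 ≤ tol)
    (hneg : ∀ j, inner ℝ (v j) (A (v j)) < 0)
    (b : OrthonormalBasis (Fin d) ℝ (Vec d)) (lam : Fin d → ℝ)
    (hb : ∀ i, A (b i) = lam i • b i) (hlam : ∀ i : Fin d, k ≤ (i : ℕ) → μ < lam i) :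
    ∑ j, ∑ i ∈ Finset.univ.filter (fun i : Fin d => k ≤ (i : ℕ)), inner ℝ (b i) (v j) ^ 2 ≤
      k ^ 2 * tol / μ ^ 2 := by
  have hj : ∀ j, ∑ i ∈ Finset.univ.filter (fun i : Fin d => k ≤ (i : ℕ)),
      inner ℝ (b i) (v j) ^ 2 ≤ k * tol / μ ^ 2 := by
    intro j
    set a := inner ℝ (v j) (A (v j)) with ha
    rw [le_div_iff₀ (by positivity), Finset.sum_mul]
    refine le_trans ?_ (norm_residual_le hA.symmetric hv hr j)
    rw [← ha, ← b.sum_sq_norm_inner_right (A (v j) - a • v j)]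
    refine (Finset.sum_le_sum fun i hi => ?_).trans
      (Finset.sum_le_sum_of_subset_of_nonneg (Finset.filter_subset _ _)
        fun _ _ _ => sq_nonneg _)
    rw [inner_sub_right, inner_smul_right, ← hA.symmetric, hb, real_inner_smul_left, ← sub_mul,
      norm_mul, mul_pow, Real.norm_eq_abs, Real.norm_eq_abs, sq_abs, sq_abs, mul_comm]
    refine mul_le_mul_of_nonneg_right ?_ (sq_nonneg _)
    have h1 := hlam i (by simpa using hi)
    have h2 := hneg j
    exact pow_le_pow_left₀ hμ.le (by linarith) 2
  calc _ ≤ ∑ j : Fin k, k * tol / μ ^ 2 := Finset.sum_le_sum fun j _ => hj j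
    _ = k ^ 2 * tol / μ ^ 2 := by
      simp
      ring

/-- The reflected operator `(I - 2 ∑ v_i v_iᵀ) A` is coercive if the `v_i` are nearly the unstable
eigenvectors of `A`. -/
theorem SpectralGap.le_inner_reflect (hA : SpectralGap A k L μ) (hkd : k ≤ d) (hμ : 0 < μ)
    (hL : 0 ≤ L) {v : Fin k → Vec d} (hv : Orthonormal ℝ v) {tol θ : ℝ}
    (hr : ∀ j, ‖searchField A v j (v j)‖ ^ 2 ≤ tol)
    (hneg : ∀ j, inner ℝ (v j) (A (v j)) < 0) (hθ : k ^ 2 * tol / μ ^ 2 ≤ θ) (w : Vec d) :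
    (μ - 4 * L * √θ) * ‖w‖ ^ 2 ≤ inner ℝ w (SaddleSearch.reflect v (A w)) := by
  have hsym := hA.symmetric
  have hnorm := hA.norm_le hL
  have hst := hA.sum_inner_stable_le hμ hv hr hneg
  obtain ⟨b, lam, -, hb, -, hneg', hpos'⟩ := hA
  replace hst := (hst b lam hb hpos').trans hθ
  set P : Vec d → Vec d := fun y => ∑ j, inner ℝ (v j) y • v j with hP
  set St := Finset.univ.filter (fun i : Fin d => k ≤ (i : ℕ)) with hSt
  set Un := Finset.univ.filter (fun i : Fin d => ¬ k ≤ (i : ℕ)) with hUn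
  have hPadd : ∀ (c : Fin d → ℝ) (y : Fin d → Vec d), P (∑ i, c i • y i) = ∑ i, c i • P (y i) := by
    intro c y
    simp only [hP, inner_sum, inner_smul_right, Finset.sum_smul, Finset.smul_sum, smul_smul]
    rw [Finset.sum_comm]
  -- `E` is the spectral projection onto the `k` unstable eigenvectors, `P` the projection onto the
  -- span of the `v_j`.
  set sg : Fin d → ℝ := fun i => if k ≤ (i : ℕ) then 0 else 1 with hsg
  set E : Vec d → Vec d := fun y => ∑ i, inner ℝ (b i) y • sg i • b i with hE
  have hPnorm : ∀ y, ‖P y‖ ^ 2 = ∑ j, inner ℝ (v j) y ^ 2 :=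
    fun y => (hv.subOrthonormal Finset.univ).norm_proj_sq y
  have hPin : ∀ y, inner ℝ (P y) y = ‖P y‖ ^ 2 :=
    fun y => (hv.subOrthonormal Finset.univ).inner_proj_self y
  have hcard : Un.card = k := by
    have : Un = Finset.univ.map (Fin.castLEEmb hkd) := by
      ext i
      simp only [hUn, Finset.mem_filter, Finset.mem_univ, true_and, not_le, Finset.mem_map]
      constructor
      · intro hi
        exact ⟨⟨i, hi⟩, rfl⟩
      · rintro ⟨j, rfl⟩
        exact j.2
    rw [this]
    simp
  have hall : ∑ i, ‖P (b i)‖ ^ 2 = k := by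
    simp only [hPnorm]
    rw [Finset.sum_comm]
    have : ∀ j, ∑ i, inner ℝ (v j) (b i) ^ 2 = 1 := by
      intro j
      have h := b.sum_sq_norm_inner_right (v j)
      rw [hv.1 j] at h
      simp only [Real.norm_eq_abs, sq_abs, one_pow] at h
      rw [← h]
      exact Finset.sum_congr rfl fun i _ => by rw [real_inner_comm]
    simp [this]
  have hSt' : ∑ i ∈ St, ‖P (b i)‖ ^ 2 ≤ θ := by
    refine le_trans (le_of_eq ?_) hst
    rw [Finset.sum_comm]
    refine Finset.sum_congr rfl fun i _ => ?_
    rw [hPnorm]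
    exact Finset.sum_congr rfl fun j _ => by rw [real_inner_comm]
  have hsplit : ∀ F : Fin d → ℝ, ∑ i, F i = ∑ i ∈ St, F i + ∑ i ∈ Un, F i := fun F =>
    (Finset.sum_filter_add_sum_filter_not _ _ _).symm
  -- The Hilbert–Schmidt distance of the two projections. Since both have trace `k`, what `P` lacks
  -- on the unstable eigenvectors equals what it has on the stable ones, so each half of the sum is
  -- at most `θ`.
  have hfrob : ∑ i, ‖P (b i) - sg i • b i‖ ^ 2 ≤ 2 * θ := by
    have h1 : ∀ i ∈ St, ‖P (b i) - sg i • b i‖ ^ 2 = ‖P (b i)‖ ^ 2 := by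
      intro i hi
      have : k ≤ (i : ℕ) := by simpa [hSt] using hi
      simp [hsg, this]
    have h2 : ∀ i ∈ Un, ‖P (b i) - sg i • b i‖ ^ 2 = 1 - ‖P (b i)‖ ^ 2 := by
      intro i hi
      have : ¬ k ≤ (i : ℕ) := by simpa [hUn] using hi
      simp only [hsg, this, if_false, one_smul]
      rw [norm_sub_sq_real, hPin, b.orthonormal.1 i]
      ring
    rw [hsplit, Finset.sum_congr rfl h1, Finset.sum_congr rfl h2, Finset.sum_sub_distrib]
    rw [hsplit] at hall
    simp only [Finset.sum_const, hcard, nsmul_eq_mul, mul_one]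
    linarith
  have hθ0 : 0 ≤ θ := (Finset.sum_nonneg fun _ _ => sq_nonneg _).trans hSt'
  have hdiff : ‖P w - E w‖ ≤ 2 * √θ * ‖w‖ := by
    have h1 : P w - E w = ∑ i, inner ℝ (b i) w • (P (b i) - sg i • b i) := by
      conv_lhs => rw [← b.sum_repr' w]
      rw [hPadd, b.sum_repr' w, hE]
      simp only [smul_sub, Finset.sum_sub_distrib]
    have h2 : ‖P w - E w‖ ^ 2 ≤ (2 * √θ * ‖w‖) ^ 2 := by
      calc ‖P w - E w‖ ^ 2 ≤ (∑ i, ‖inner ℝ (b i) w‖ * ‖P (b i) - sg i • b i‖) ^ 2 := by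
            rw [h1]
            refine pow_le_pow_left₀ (norm_nonneg _) ((norm_sum_le _ _).trans_eq ?_) 2
            exact Finset.sum_congr rfl fun i _ => norm_smul _ _
        _ ≤ (∑ i, ‖inner ℝ (b i) w‖ ^ 2) * ∑ i, ‖P (b i) - sg i • b i‖ ^ 2 :=
            Finset.sum_mul_sq_le_sq_mul_sq _ _ _
        _ ≤ ‖w‖ ^ 2 * (2 * θ) := by
            rw [b.sum_sq_norm_inner_right]
            exact mul_le_mul_of_nonneg_left hfrob (sq_nonneg _)
        _ ≤ (2 * √θ * ‖w‖) ^ 2 := by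
            rw [mul_pow, mul_pow, Real.sq_sqrt hθ0]
            nlinarith [mul_nonneg (sq_nonneg ‖w‖) hθ0]
    exact le_of_sq_le_sq h2 (by positivity)
  -- With the exact projection the reflection flips the signs of the negative eigenvalues, so every
  -- eigenvalue becomes larger than `μ`.
  have hmain : μ * ‖w‖ ^ 2 ≤ inner ℝ w (A w) - 2 * inner ℝ (E w) (A w) := by
    have hin : ∀ i, inner ℝ (b i) (A w) = lam i * inner ℝ (b i) w := by
      intro i
      rw [← hsym, hb, real_inner_smul_left]
    have h1 : inner ℝ w (A w) - 2 * inner ℝ (E w) (A w) =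
        ∑ i, (1 - 2 * sg i) * lam i * inner ℝ (b i) w ^ 2 := by
      rw [← b.sum_inner_mul_inner w (A w), hE]
      simp only [sum_inner, real_inner_smul_left, hin]
      rw [Finset.mul_sum, ← Finset.sum_sub_distrib]
      refine Finset.sum_congr rfl fun i _ => ?_
      rw [real_inner_comm]
      ring
    rw [h1, ← b.sum_sq_norm_inner_right w, Finset.mul_sum]
    refine Finset.sum_le_sum fun i _ => ?_
    rw [Real.norm_eq_abs, sq_abs]
    refine mul_le_mul_of_nonneg_right ?_ (sq_nonneg _)
    by_cases hi : k ≤ (i : ℕ)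
    · have := hpos' i hi
      simp [hsg, hi]
      linarith
    · have := hneg' i (not_le.1 hi)
      simp [hsg, hi]
      linarith
  have hsymP : inner ℝ w (P (A w)) = inner ℝ (P w) (A w) := by
    simp only [hP, inner_sum, sum_inner, real_inner_smul_left, inner_smul_right]
    refine Finset.sum_congr rfl fun i _ => ?_
    rw [real_inner_comm w (v i)]
    ring
  have hcs : inner ℝ (P w - E w) (A w) ≤ 2 * √θ * ‖w‖ * (L * ‖w‖) := by
    refine (real_inner_le_norm _ _).trans (mul_le_mul hdiff ?_ (norm_nonneg _) (by positivity))
    exact (A.le_opNorm w).trans (mul_le_mul_of_nonneg_right hnorm (norm_nonneg _))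
  have hfin : inner ℝ w (SaddleSearch.reflect v (A w)) =
      inner ℝ w (A w) - 2 * inner ℝ (P w) (A w) := by
    rw [SaddleSearch.reflect, inner_sub_right, inner_smul_right, ← hsymP]
  rw [hfin]
  rw [inner_sub_left] at hcs
  nlinarith [hcs, hmain]

end Spectral

/-! ### Measurability of the iterates -/

section Measurability

variable {Ω : Type*} [MeasurableSpace Ω] {d k : ℕ}

theorem measurable_clm_apply {A : Ω → Vec d →L[ℝ] Vec d} {u : Ω → Vec d} (hA : Measurable A)
    (hu : Measurable u) : Measurable fun ω => A ω (u ω) :=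
  (isBoundedBilinearMap_apply (𝕜 := ℝ) (E := Vec d) (F := Vec d)).continuous.measurable.comp
    (hA.prodMk hu)

theorem measurable_normalize {u : Ω → Vec d} (hu : Measurable u) :
    Measurable fun ω => NormedSpace.normalize (u ω) := by
  simp only [NormedSpace.normalize]
  fun_prop

theorem measurable_prevProj {v : Ω → Fin k → Vec d} {u : Ω → Vec d} (hv : Measurable v)
    (hu : Measurable u) (j : Fin k) : Measurable fun ω => prevProj (v ω) j (u ω) := by
  simp only [prevProj]
  fun_prop

theorem measurable_searchField {A : Ω → Vec d →L[ℝ] Vec d} {v : Ω → Fin k → Vec d}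
    {u : Ω → Vec d} (hA : Measurable A) (hv : Measurable v) (hu : Measurable u) (j : Fin k) :
    Measurable fun ω => searchField (A ω) (v ω) j (u ω) := by
  have hAu := measurable_clm_apply hA hu
  have hP := measurable_prevProj hv hAu j
  simp only [searchField]
  exact (hAu.fun_sub ((hu.inner hAu).fun_smul hu)).fun_sub hP

theorem measurable_searchIter {A : ℕ → Ω → Vec d →L[ℝ] Vec d} {v : Ω → Fin k → Vec d}
    (hv : Measurable v) (β : ℕ → ℝ) (j : Fin k) (l : ℕ) (hA : ∀ i < l, Measurable (A i)) :
    Measurable fun ω => searchIter (fun i => A i ω) β (v ω) j l := by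
  induction l with
  | zero =>
    have hj : Measurable fun ω => v ω j := by fun_prop
    have hP := measurable_prevProj hv hj j
    simp only [searchIter]
    exact measurable_normalize (by fun_prop)
  | succ l ih =>
    have hu := ih fun i hi => hA i (hi.trans (Nat.lt_succ_self l))
    have hF := measurable_searchField (hA l (Nat.lt_succ_self l)) hv hu j
    simp only [searchIter]
    exact measurable_normalize (by fun_prop)

/-- The level set of `0` has an extra piece, the event that no `p l` occurs, because `sInf ∅ = 0`.
-/
theorem measurable_sInf_nat {p : ℕ → Set Ω} (hp : ∀ l, MeasurableSet (p l)) :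
    Measurable fun ω => sInf {l | ω ∈ p l} := by
  refine measurable_to_countable' fun n => ?_
  have : (fun ω => sInf {l | ω ∈ p l}) ⁻¹' {n} =
      (p n ∩ ⋂ l ∈ {l | l < n}, (p l)ᶜ) ∪ {ω | n = 0 ∧ ∀ l, ω ∈ (p l)ᶜ} := by
    ext ω
    simp only [Set.mem_preimage, Set.mem_singleton_iff, Set.mem_union, Set.mem_inter_iff,
      Set.mem_iInter, Set.mem_compl_iff, Set.mem_ofPred_eq]
    constructor
    · intro h
      rcases Set.eq_empty_or_nonempty {l | ω ∈ p l} with he | hne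
      · right
        rw [he, Nat.sInf_empty] at h
        exact ⟨h.symm, fun l hl => (Set.eq_empty_iff_forall_notMem.1 he) l hl⟩
      · left
        rw [← h]
        exact ⟨Nat.sInf_mem hne, fun l hl => Nat.notMem_of_lt_sInf hl⟩
    · rintro (⟨h1, h2⟩ | ⟨rfl, h⟩)
      · refine le_antisymm (Nat.sInf_le h1) ?_
        by_contra hlt
        exact h2 _ (not_le.1 hlt) (Nat.sInf_mem (s := {l | ω ∈ p l}) ⟨n, h1⟩)
      · have : {l | ω ∈ p l} = ∅ := Set.eq_empty_iff_forall_notMem.2 h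
        rw [this, Nat.sInf_empty]
  rw [this]
  refine ((hp n).inter (MeasurableSet.biInter (Set.to_countable _) fun l _ => (hp l).compl)).union ?_
  by_cases hn : n = 0
  · simp only [hn, true_and]
    rw [Set.ofPred_forall]
    exact MeasurableSet.iInter fun l => (hp l).compl
  · simp [hn]

/-- An iterate taken at a measurable random index is measurable, as there are countably many
indices. Only samples of directions below `j` enter; the independence of the samples of loop `j`
rests on this. -/
theorem measurable_searchUpTo {H : Ω → Vec d →L[ℝ] Vec d}
    {A : Fin k → ℕ → Ω → Vec d →L[ℝ] Vec d} {v : Ω → Fin k → Vec d} (hH : Measurable H)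
    (hv : Measurable v) (tol : ℝ) (β : ℕ → ℝ) (j : ℕ)
    (hA : ∀ i : Fin k, (i : ℕ) < j → ∀ l, Measurable (A i l)) :
    Measurable fun ω => searchUpTo (H ω) tol (fun i l => A i l ω) β (v ω) j := by
  induction j with
  | zero => exact hv
  | succ j ih =>
    have hV := ih fun i hi => hA i (hi.trans (Nat.lt_succ_self j))
    by_cases hj : j < k
    · have hAj := hA ⟨j, hj⟩ (Nat.lt_succ_self j)
      have hu := fun l => measurable_searchIter hV β ⟨j, hj⟩ l fun i _ => hAj i
      have hN : Measurable fun ω => sInf (stopTimes (H ω) tol (fun l => A ⟨j, hj⟩ l ω) β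
          (searchUpTo (H ω) tol (fun i l => A i l ω) β (v ω) j) ⟨j, hj⟩) :=
        measurable_sInf_nat fun l => measurableSet_lt
          ((measurable_searchField hH hV (hu l) ⟨j, hj⟩).norm.pow_const 2) measurable_const
      have hres := (measurable_from_prod_countable_right
        (f := fun q : ℕ × Ω => searchIter (fun l => A ⟨j, hj⟩ l q.2) β
          (searchUpTo (H q.2) tol (fun i l => A i l q.2) β (v q.2) j) ⟨j, hj⟩ q.1) hu).comp
        (hN.prodMk measurable_id)
      simp only [searchUpTo, dif_pos hj]
      refine measurable_pi_iff.2 fun i => ?_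
      by_cases hi : i = ⟨j, hj⟩
      · subst hi
        simp only [Function.update_self]
        exact hres
      · simp only [Function.update_of_ne hi]
        exact (measurable_pi_apply i).comp hV
    · simp only [searchUpTo, dif_neg hj]
      exact hV

theorem SaddleSearch.measurable_reflect {v : Ω → Fin k → Vec d} {u : Ω → Vec d}
    (hv : Measurable v) (hu : Measurable u) : Measurable fun ω => reflect (v ω) (u ω) := by
  simp only [reflect]
  fun_prop

end Measurability

/-! ### Independence of the past and a fresh sample -/

section Independence

variable {Ω S : Type*} {m mΩ : MeasurableSpace Ω} [MeasurableSpace S] {P : Measure Ω}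

theorem map_prodMk_restrict_of_indep [IsProbabilityMeasure P] {X : Type*} [MeasurableSpace X]
    (hm : m ≤ mΩ) {x : Ω → X} {y : Ω → S} {A : Set Ω}
    (hind : Indep m (MeasurableSpace.comap y inferInstance) P) (hy : Measurable y)
    (hx : Measurable[m] x) (hA : MeasurableSet[m] A) :
    (P.restrict A).map (fun ω => (x ω, y ω)) = ((P.restrict A).map x).prod (P.map y) := by
  have hx' : Measurable x := hx.mono hm le_rfl
  symm
  have : IsProbabilityMeasure (P.map y) := Measure.isProbabilityMeasure_map hy.aemeasurable
  refine Measure.prod_eq fun s t hs ht => ?_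
  rw [Measure.map_apply (hx'.prodMk hy) (hs.prod ht), Measure.map_apply hx' hs,
    Measure.map_apply hy ht, Measure.restrict_apply ((hx'.prodMk hy) (hs.prod ht)),
    Measure.restrict_apply (hx' hs)]
  have h := (Indep_iff _ _ _).1 hind (x ⁻¹' s ∩ A) (y ⁻¹' t)
    (@MeasurableSet.inter _ m _ _ (hx hs) hA) ⟨t, ht, rfl⟩
  rw [← h]
  congr 1
  ext ω
  simp only [Set.mem_inter_iff, Set.mem_preimage, Set.mem_prod]
  tauto

/-- This replaces conditioning on the past `m`: on an event of the past, the joint law of the past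
state and the fresh sample is a product, so Tonelli integrates the sample out first. Values in
`ENNReal` make integrability conditions unnecessary. -/
theorem setLIntegral_le_of_indep [IsProbabilityMeasure P] {X : Type*} [MeasurableSpace X]
    (hm : m ≤ mΩ) {x : Ω → X} {y : Ω → S} {A : Set Ω} {ν : Measure S}
    (hind : Indep m (MeasurableSpace.comap y inferInstance) P) (hy : MeasurePreserving y P ν)
    (hx : Measurable[m] x) (hA : MeasurableSet[m] A) {F : X → S → ENNReal}
    (hF : Measurable (Function.uncurry F)) {B : Ω → ENNReal}
    (hB : ∀ᵐ ω ∂P.restrict A, ∫⁻ s, F (x ω) s ∂ν ≤ B ω) :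
    ∫⁻ ω in A, F (x ω) (y ω) ∂P ≤ ∫⁻ ω in A, B ω ∂P := by
  have hx' : Measurable x := hx.mono hm le_rfl
  have : IsProbabilityMeasure ν := by
    rw [← hy.map_eq]
    exact Measure.isProbabilityMeasure_map hy.measurable.aemeasurable
  have h1 : ∫⁻ ω in A, F (x ω) (y ω) ∂P =
      ∫⁻ q, Function.uncurry F q ∂((P.restrict A).map fun ω => (x ω, y ω)) := by
    rw [lintegral_map hF (hx'.prodMk hy.measurable)]
    rfl
  rw [h1, map_prodMk_restrict_of_indep hm hind hy.measurable hx hA, hy.map_eq,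
    lintegral_prod _ hF.aemeasurable, lintegral_map hF.lintegral_prod_right' hx']
  exact lintegral_mono_ae hB

/-- The `σ`-algebra generated by the samples with index in `T`. -/
@[reducible]
def sampleSigma {ι : Type*} (Z : ι → Ω → S) (T : Set ι) : MeasurableSpace Ω :=
  ⨆ i ∈ T, MeasurableSpace.comap (Z i) inferInstance

variable {ι : Type*} {Z : ι → Ω → S}

theorem measurable_sampleSigma {T : Set ι} {i : ι} (hi : i ∈ T) :
    Measurable[sampleSigma Z T] (Z i) := by
  refine Measurable.mono (comap_measurable (Z i)) ?_ le_rfl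
  exact le_iSup₂_of_le i hi le_rfl

theorem sampleSigma_le (hZ : ∀ i, Measurable (Z i)) (T : Set ι) : sampleSigma Z T ≤ mΩ :=
  iSup₂_le fun i _ => (hZ i).comap_le

theorem indep_sampleSigma (hZ : ∀ i, Measurable (Z i)) (hind : iIndepFun Z P) {T : Set ι}
    {i : ι} (hi : i ∉ T) :
    Indep (sampleSigma Z T) (MeasurableSpace.comap (Z i) inferInstance) P := by
  have h := indep_iSup_of_disjoint (fun i => (hZ i).comap_le) hind
    (S := T) (T := {i}) (by simpa using hi)
  simpa [sampleSigma] using h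

end Independence

/-! ### The eigenvector search stops almost surely -/

section SearchStops

variable {d k : ℕ}

/-- The matrix `I - u uᵀ - ∑ v_i v_iᵀ` is symmetric and can be moved to the other factor. The sample
then appears only as `A u`, whose mean is known. -/
theorem inner_searchField_eq (v : Fin k → Vec d) (j : Fin k) (A H : Vec d →L[ℝ] Vec d)
    (u : Vec d) :
    inner ℝ (searchField A v j u) (H u) = inner ℝ (A u) (searchField H v j u) := by
  simp only [searchField, prevProj, inner_sub_left, inner_sub_right, real_inner_smul_left,
    inner_smul_right, inner_sum, sum_inner, real_inner_comm u (A u)]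
  congr 1
  · ring
  · refine Finset.sum_congr rfl fun i _ => ?_
    rw [real_inner_comm (v i) (A u)]
    ring

/-- Since `u ⟂ w`, normalization divides by `1 + β²‖w‖²`. The quadratic term and the effect of this
division are each at most `L β²‖w‖²`. -/
theorem rayleigh_step_le {H : Vec d →L[ℝ] Vec d} {L : ℝ}
    (hsym : ∀ x y, inner ℝ (H x) y = inner ℝ x (H y)) (hL : ‖H‖ ≤ L) {u w : Vec d}
    (hu : ‖u‖ = 1) (huw : inner ℝ u w = 0) (β : ℝ) :
    inner ℝ (NormedSpace.normalize (u - β • w)) (H (NormedSpace.normalize (u - β • w))) ≤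
      inner ℝ u (H u) - 2 * β * inner ℝ w (H u) + 2 * L * (β ^ 2 * ‖w‖ ^ 2) := by
  have hform : ∀ y, |inner ℝ y (H y)| ≤ L * ‖y‖ ^ 2 := by
    intro y
    refine (abs_real_inner_le_norm _ _).trans ?_
    have := (H.le_opNorm y).trans (mul_le_mul_of_nonneg_right hL (norm_nonneg y))
    nlinarith [norm_nonneg y]
  set y := u - β • w with hy
  have hnorm : ‖y‖ ^ 2 = 1 + β ^ 2 * ‖w‖ ^ 2 := by
    rw [hy, norm_sub_sq_real, inner_smul_right, huw, norm_smul, hu, mul_pow, Real.norm_eq_abs,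
      sq_abs]
    ring
  have hy0 : y ≠ 0 := by
    intro h
    rw [h, norm_zero] at hnorm
    nlinarith [mul_nonneg (sq_nonneg β) (sq_nonneg ‖w‖)]
  set y' := NormedSpace.normalize y with hy'
  have hyy : y = ‖y‖ • y' := by
    rw [hy', NormedSpace.normalize, smul_smul, mul_inv_cancel₀ (norm_ne_zero_iff.2 hy0), one_smul]
  have hy1 : ‖y'‖ = 1 := NormedSpace.norm_normalize hy0
  have h1 : inner ℝ y (H y) = ‖y‖ ^ 2 * inner ℝ y' (H y') := by
    conv_lhs => rw [hyy]
    rw [map_smul, real_inner_smul_left, inner_smul_right]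
    ring
  have h2 : inner ℝ y (H y) =
      inner ℝ u (H u) - 2 * β * inner ℝ w (H u) + β ^ 2 * inner ℝ w (H w) := by
    rw [hy]
    simp only [map_sub, map_smul, inner_sub_left, inner_sub_right, real_inner_smul_left,
      inner_smul_right]
    rw [← hsym u w, real_inner_comm w (H u)]
    ring
  have h3 := abs_le.1 (hform y')
  have h4 := abs_le.1 (hform w)
  rw [hy1] at h3
  have h5 := mul_nonneg (sq_nonneg β) (sq_nonneg ‖w‖)
  rw [h1, hnorm] at h2
  nlinarith [mul_le_mul_of_nonneg_left h4.2 (sq_nonneg β), mul_nonneg h5 (by linarith [h3.1] :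
    (0 : ℝ) ≤ inner ℝ y' (H y') + L)]

/-- One step of the search decreases the expected Rayleigh quotient. -/
theorem lintegral_search_step_le {S : Type*} [MeasurableSpace S] {ν : Measure S}
    [IsProbabilityMeasure ν] {A : S → Vec d →L[ℝ] Vec d} {H : Vec d →L[ℝ] Vec d} {L G β : ℝ}
    (hA : Measurable A) (hG : ∀ᵐ s ∂ν, ‖A s‖ ≤ G) (hmean : ∫ s, A s ∂ν = H)
    (hsym : ∀ x y, inner ℝ (H x) y = inner ℝ x (H y)) (hL : ‖H‖ ≤ L) (hβ : 0 ≤ β)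
    {v : Fin k → Vec d} {j : Fin k} (hv : SubOrthonormal (Finset.Iio j) v) {u : Vec d}
    (hu : ∀ i < j, inner ℝ (v i) u = 0) (hu1 : u = 0 ∨ ‖u‖ = 1) :
    ∫⁻ s, ENNReal.ofReal
        (inner ℝ (NormedSpace.normalize (u - β • searchField (A s) v j u))
          (H (NormedSpace.normalize (u - β • searchField (A s) v j u))) + L +
          2 * β * ‖searchField H v j u‖ ^ 2) ∂ν ≤
      ENNReal.ofReal (inner ℝ u (H u) + L + 2 * L * G ^ 2 * β ^ 2) := by
  have hL0 : 0 ≤ L := (norm_nonneg H).trans hL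
  have hint : Integrable A ν := Integrable.of_bound hA.aestronglyMeasurable G hG
  have hintu : Integrable (fun s => inner ℝ (searchField H v j u) (A s u)) ν :=
    (ContinuousLinearMap.integrable_comp (ContinuousLinearMap.apply ℝ (Vec d) u) hint).const_inner _
  have hlow : ∀ y : Vec d, ‖y‖ ≤ 1 → 0 ≤ inner ℝ y (H y) + L := by
    intro y hy
    have h1 := (abs_le.1 (abs_real_inner_le_norm y (H y))).1
    have h2 := (H.le_opNorm y).trans (mul_le_mul_of_nonneg_right hL (norm_nonneg y))
    nlinarith [norm_nonneg y, norm_nonneg (H y), mul_nonneg hL0 (norm_nonneg y)]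
  -- The residual is on both sides: on the left it keeps a nonnegative integrand without subtraction
  -- in `ENNReal`, on the right it cancels against the mean of the inner product.
  have hpt : ∀ᵐ s ∂ν, inner ℝ (NormedSpace.normalize (u - β • searchField (A s) v j u))
          (H (NormedSpace.normalize (u - β • searchField (A s) v j u))) + L +
          2 * β * ‖searchField H v j u‖ ^ 2 ≤
        inner ℝ u (H u) + L + 2 * L * G ^ 2 * β ^ 2 + 2 * β * ‖searchField H v j u‖ ^ 2 -
          2 * β * inner ℝ (searchField H v j u) (A s u) := by
    filter_upwards [hG] with s hs
    have hw := norm_searchField_le hv (A s) hu hu1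
    have hw2 : ‖searchField (A s) v j u‖ ^ 2 ≤ G ^ 2 :=
      pow_le_pow_left₀ (norm_nonneg _) (hw.trans hs) 2
    rw [real_inner_comm (A s u), ← inner_searchField_eq]
    rcases hu1 with h0 | h1
    · subst h0
      have : searchField (A s) v j 0 = 0 := by simp [searchField, prevProj]
      simp only [this, smul_zero, sub_zero]
      have hn : NormedSpace.normalize (0 : Vec d) = 0 := by simp [NormedSpace.normalize]
      rw [hn]
      simp only [map_zero, inner_zero_left]
      nlinarith [mul_nonneg (mul_nonneg hL0 (sq_nonneg G)) (sq_nonneg β)]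
    · have := rayleigh_step_le hsym hL h1 (inner_self_searchField (A s) hu (Or.inr h1)) β
      nlinarith [mul_le_mul_of_nonneg_left hw2 (mul_nonneg hL0 (sq_nonneg β))]
  refine (lintegral_mono_ae (hpt.mono fun s hs => ENNReal.ofReal_le_ofReal hs)).trans ?_
  rw [← ofReal_integral_eq_lintegral_ofReal]
  · refine ENNReal.ofReal_le_ofReal (le_of_eq ?_)
    rw [integral_sub (integrable_const _) (hintu.const_mul _), integral_const_mul,
      integral_inner (f := fun s => A s u) (ContinuousLinearMap.integrable_comp
        (ContinuousLinearMap.apply ℝ (Vec d) u) hint), integral_const,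
      ← ContinuousLinearMap.integral_apply hint, hmean, inner_searchField_apply hv H hu hu1]
    simp
  · exact (integrable_const _).sub (hintu.const_mul _)
  · filter_upwards [hpt] with s hs
    refine le_trans ?_ hs
    have := hlow (NormedSpace.normalize (u - β • searchField (A s) v j u)) (by
      rcases normalize_eq_zero_or (u - β • searchField (A s) v j u) with h | h
      · rw [h]
        simp
      · exact h.le)
    positivity

end SearchStops

/-! ### From expected decrease to almost sure stopping. -/

section SearchStops

variable {d k : ℕ}

theorem abs_inner_apply_le {H : Vec d →L[ℝ] Vec d} {L : ℝ} (hL : ‖H‖ ≤ L) {u : Vec d}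
    (hu : ‖u‖ ≤ 1) : |inner ℝ u (H u)| ≤ L := by
  refine (abs_real_inner_le_norm u (H u)).trans ?_
  have h2 := (H.le_opNorm u).trans (mul_le_mul_of_nonneg_right hL (norm_nonneg u))
  have hL0 : 0 ≤ L := (norm_nonneg H).trans hL
  nlinarith [norm_nonneg u, norm_nonneg (H u), mul_nonneg hL0 (norm_nonneg u)]

theorem measure_eq_zero_of_forall_sum_mul_le {Ω : Type*} [MeasurableSpace Ω] {P : Measure Ω}
    [IsFiniteMeasure P] {N : Set Ω} {β : ℕ → ℝ} (hβ : ∀ l, 0 ≤ β l) (hsum : ¬ Summable β) {K : ℝ}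
    (h : ∀ n, ENNReal.ofReal (∑ l ∈ Finset.range n, β l) * P N ≤ ENNReal.ofReal K) : P N = 0 := by
  by_contra hN
  have hpos : 0 < (P N).toReal := ENNReal.toReal_pos hN (measure_ne_top P N)
  refine hsum (summable_of_sum_range_le (c := max K 0 / (P N).toReal) hβ fun n => ?_)
  have h1 := ENNReal.toReal_mono ENNReal.ofReal_ne_top (h n)
  rw [ENNReal.toReal_mul, ENNReal.toReal_ofReal (Finset.sum_nonneg fun l _ => hβ l),
    ENNReal.toReal_ofReal'] at h1
  rwa [le_div_iff₀ hpos]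

/-- A single loop of the eigenvector search, at a random point of `B` that is independent of the
samples of the loop, stops almost surely. -/
theorem ae_stopTimes_nonempty {Ω S : Type*} [mΩ : MeasurableSpace Ω] [MeasurableSpace S]
    {P : Measure Ω} [IsProbabilityMeasure P] {ν : Measure S} [IsProbabilityMeasure ν]
    {m : ℕ → MeasurableSpace Ω} (hm : ∀ l, m l ≤ mΩ) {Y : ℕ → Ω → S}
    (hY : ∀ l, MeasurePreserving (Y l) P ν)
    (hind : ∀ l, Indep (m l) (MeasurableSpace.comap (Y l) inferInstance) P)
    (hYm : ∀ l, ∀ i < l, Measurable[m l] (Y i))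
    {f : Vec d → ℝ} {h : Vec d → S → Vec d →L[ℝ] Vec d} {σ G L μ tol : ℝ} {B : Set (Vec d)}
    (hh : UnbiasedHessian f h ν σ G B) (hgap : ∀ x ∈ B, SpectralGap (hessian f x) k L μ)
    (hH : Measurable (hessian f)) (hL : 0 ≤ L) (htol : 0 < tol) {β : ℕ → ℝ}
    (hβ : DecayStepSize β) {x : Ω → Vec d} {v : Ω → Fin k → Vec d} {j : Fin k}
    (hx : ∀ l, Measurable[m l] x) (hv : ∀ l, Measurable[m l] v)
    (hsub : ∀ ω, SubOrthonormal (Finset.Iio j) (v ω)) {A : Set Ω}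
    (hA : ∀ l, MeasurableSet[m l] A) (hAB : ∀ ω ∈ A, x ω ∈ B) :
    ∀ᵐ ω ∂P, ω ∈ A →
      (stopTimes (hessian f (x ω)) tol (fun l => h (x ω) (Y l ω)) β (v ω) j).Nonempty := by
  set u : ℕ → Ω → Vec d := fun l ω => searchIter (fun i => h (x ω) (Y i ω)) β (v ω) j l with hu
  have hum : ∀ l, Measurable[m l] (u l) := fun l =>
    @measurable_searchIter Ω (m l) d k (fun i ω => h (x ω) (Y i ω)) v (hv l) β j l
      fun i hi => hh.measurable.comp ((hx l).prodMk (hYm l i hi))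
  have hum' : ∀ l, Measurable (u l) := fun l => (hum l).mono (hm l) le_rfl
  have hx' : Measurable x := (hx 0).mono (hm 0) le_rfl
  have hv' : Measurable v := (hv 0).mono (hm 0) le_rfl
  have hA' : MeasurableSet A := hm 0 _ (hA 0)
  have hHx : Measurable fun ω => hessian f (x ω) := hH.comp hx'
  have hinv : ∀ l ω, (u l ω = 0 ∨ ‖u l ω‖ = 1) ∧ ∀ i < j, inner ℝ (v ω i) (u l ω) = 0 :=
    fun l ω => searchIter_invariant (hsub ω) _ β l
  have hu1 : ∀ l ω, ‖u l ω‖ ≤ 1 := fun l ω => by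
    rcases (hinv l ω).1 with h | h <;> simp [h]
  have hnormH : ∀ ω ∈ A, ‖hessian f (x ω)‖ ≤ L := fun ω hω => (hgap _ (hAB ω hω)).norm_le hL
  -- The Rayleigh quotient, shifted by `L` to be nonnegative on `A`.
  set φ : ℕ → Ω → ℝ := fun l ω => inner ℝ (u l ω) (hessian f (x ω) (u l ω)) + L with hφ
  have hφm : ∀ l, Measurable (φ l) := fun l =>
    ((hum' l).inner (measurable_clm_apply hHx (hum' l))).add_const L
  have hφ0 : ∀ l, ∀ ω ∈ A, 0 ≤ φ l ω := fun l ω hω => by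
    have := (abs_le.1 (abs_inner_apply_le (hnormH ω hω) (hu1 l ω))).1
    simp only [hφ]
    linarith
  set r : ℕ → Ω → ℝ := fun l ω => ‖searchField (hessian f (x ω)) (v ω) j (u l ω)‖ ^ 2 with hr
  have hrm : ∀ l, Measurable (r l) := fun l =>
    (measurable_searchField hHx hv' (hum' l) j).norm.pow_const 2
  set N : Set Ω := A ∩ {ω | ∀ l, tol ≤ r l ω} with hN
  have hNm : MeasurableSet N := by
    refine hA'.inter ?_
    rw [Set.ofPred_forall]
    exact MeasurableSet.iInter fun l => measurableSet_le measurable_const (hrm l)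
  have hstep : ∀ l, ∫⁻ ω in A, ENNReal.ofReal (φ (l + 1) ω) ∂P +
      ENNReal.ofReal (2 * β l * tol) * P N ≤
      ∫⁻ ω in A, ENNReal.ofReal (φ l ω) ∂P + ENNReal.ofReal (2 * L * G ^ 2 * β l ^ 2) := by
    intro l
    have hβl := (hβ.pos l).le
    set F : Vec d × (Fin k → Vec d) × Vec d → S → ENNReal := fun q s => ENNReal.ofReal
      (inner ℝ (NormedSpace.normalize (q.2.2 - β l • searchField (h q.1 s) q.2.1 j q.2.2))
        (hessian f q.1
          (NormedSpace.normalize (q.2.2 - β l • searchField (h q.1 s) q.2.1 j q.2.2))) + L +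
        2 * β l * ‖searchField (hessian f q.1) q.2.1 j q.2.2‖ ^ 2) with hF
    have hFm : Measurable (Function.uncurry F) := by
      have e1 : Measurable fun q : (Vec d × (Fin k → Vec d) × Vec d) × S => q.1.1 := by fun_prop
      have e2 : Measurable fun q : (Vec d × (Fin k → Vec d) × Vec d) × S => q.1.2.1 := by fun_prop
      have e3 : Measurable fun q : (Vec d × (Fin k → Vec d) × Vec d) × S => q.1.2.2 := by fun_prop
      have e4 : Measurable fun q : (Vec d × (Fin k → Vec d) × Vec d) × S => h q.1.1 q.2 :=
        hh.measurable.comp (e1.prodMk measurable_snd)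
      have e5 := measurable_normalize
        (e3.fun_sub ((measurable_searchField e4 e2 e3 j).fun_const_smul (β l)))
      have e6 := (e5.inner (measurable_clm_apply (hH.comp e1) e5)).add_const L
      have e7 := (measurable_searchField (hH.comp e1) e2 e3 j).norm.pow_const 2
      exact (e6.fun_add (e7.const_mul (2 * β l))).ennreal_ofReal
    have key := setLIntegral_le_of_indep (hm l) (x := fun ω => (x ω, v ω, u l ω)) (hind l) (hY l)
      ((hx l).prodMk ((hv l).prodMk (hum l))) (hA l) hFm
      (B := fun ω => ENNReal.ofReal (φ l ω + 2 * L * G ^ 2 * β l ^ 2)) (by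
        filter_upwards [ae_restrict_mem hA'] with ω hω
        exact lintegral_search_step_le (hh.measurable.comp measurable_prodMk_left)
          (hh.bounded _ (hAB ω hω)) (hh.mean _ (hAB ω hω)) (hgap _ (hAB ω hω)).symmetric
          (hnormH ω hω) hβl (hsub ω) (hinv l ω).2 (hinv l ω).1)
    -- On `N`, where the test never succeeds, the residual is at least `tol`; elsewhere on `A` it is
    -- only used to be nonnegative.
    have hleft : ∫⁻ ω in A, ENNReal.ofReal (φ (l + 1) ω) ∂P +
        ENNReal.ofReal (2 * β l * tol) * P N ≤
        ∫⁻ ω in A, F (x ω, v ω, u l ω) (Y l ω) ∂P := by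
      have h1 : ∫⁻ ω in A, F (x ω, v ω, u l ω) (Y l ω) ∂P =
          ∫⁻ ω in A, (ENNReal.ofReal (φ (l + 1) ω) + ENNReal.ofReal (2 * β l * r l ω)) ∂P := by
        refine setLIntegral_congr_fun hA' fun ω hω => ?_
        rw [← ENNReal.ofReal_add (hφ0 (l + 1) ω hω) (mul_nonneg (by positivity) (sq_nonneg _))]
        rfl
      rw [h1, lintegral_add_left (hφm (l + 1)).ennreal_ofReal]
      refine add_le_add le_rfl ?_
      calc ENNReal.ofReal (2 * β l * tol) * P N
          = ∫⁻ ω in N, ENNReal.ofReal (2 * β l * tol) ∂P := (setLIntegral_const _ _).symm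
        _ ≤ ∫⁻ ω in N, ENNReal.ofReal (2 * β l * r l ω) ∂P :=
            setLIntegral_mono' hNm fun ω hω => ENNReal.ofReal_le_ofReal
              (mul_le_mul_of_nonneg_left (hω.2 l) (by positivity))
        _ ≤ ∫⁻ ω in A, ENNReal.ofReal (2 * β l * r l ω) ∂P :=
            lintegral_mono_set Set.inter_subset_left
    refine (hleft.trans key).trans ?_
    calc ∫⁻ ω in A, ENNReal.ofReal (φ l ω + 2 * L * G ^ 2 * β l ^ 2) ∂P
        ≤ ∫⁻ ω in A, (ENNReal.ofReal (φ l ω) + ENNReal.ofReal (2 * L * G ^ 2 * β l ^ 2)) ∂P :=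
          lintegral_mono fun ω => ENNReal.ofReal_add_le
      _ = ∫⁻ ω in A, ENNReal.ofReal (φ l ω) ∂P + ENNReal.ofReal (2 * L * G ^ 2 * β l ^ 2) * P A := by
          rw [lintegral_add_right _ measurable_const, setLIntegral_const]
      _ ≤ _ := add_le_add le_rfl (mul_le_of_le_one_right zero_le prob_le_one)
  have hsum : ∀ n, ∫⁻ ω in A, ENNReal.ofReal (φ n ω) ∂P +
      ENNReal.ofReal (∑ l ∈ Finset.range n, 2 * β l * tol) * P N ≤
      ENNReal.ofReal (2 * L + ∑ l ∈ Finset.range n, 2 * L * G ^ 2 * β l ^ 2) := by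
    intro n
    induction n with
    | zero =>
      simp only [Finset.range_zero, Finset.sum_empty, ENNReal.ofReal_zero, zero_mul, add_zero]
      calc ∫⁻ ω in A, ENNReal.ofReal (φ 0 ω) ∂P ≤ ∫⁻ ω in A, ENNReal.ofReal (2 * L) ∂P := by
            refine setLIntegral_mono' hA' fun ω hω => ENNReal.ofReal_le_ofReal ?_
            have := (abs_le.1 (abs_inner_apply_le (hnormH ω hω) (hu1 0 ω))).2
            simp only [hφ]
            linarith
        _ ≤ _ := by
            rw [setLIntegral_const]
            exact mul_le_of_le_one_right zero_le prob_le_one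
    | succ n ih =>
      have hnn : ∀ n, 0 ≤ ∑ l ∈ Finset.range n, 2 * L * G ^ 2 * β l ^ 2 := fun n =>
        Finset.sum_nonneg fun l _ => by positivity
      rw [Finset.sum_range_succ, Finset.sum_range_succ, ← add_assoc (2 * L),
        ENNReal.ofReal_add (Finset.sum_nonneg fun l _ => by
          have := hβ.pos l
          positivity) (by
          have := hβ.pos n
          positivity), ENNReal.ofReal_add (by linarith [hnn n]) (by positivity), add_mul,
        add_left_comm]
      calc _ ≤ ENNReal.ofReal (∑ l ∈ Finset.range n, 2 * β l * tol) * P N +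
            (∫⁻ ω in A, ENNReal.ofReal (φ n ω) ∂P +
              ENNReal.ofReal (2 * L * G ^ 2 * β n ^ 2)) := add_le_add le_rfl (hstep n)
        _ ≤ _ := by
            rw [← add_assoc, add_comm (_ * P N)]
            exact add_le_add ih le_rfl
  have hnotsum : ¬ Summable fun l => 2 * β l * tol := by
    intro hs
    refine hβ.not_summable ?_
    have := hs.mul_left (1 / (2 * tol))
    refine this.congr fun l => ?_
    field_simp
  have hN0 : P N = 0 := by
    refine measure_eq_zero_of_forall_sum_mul_le (fun l => ?_) hnotsum
      (K := 2 * L + ∑' l, 2 * L * G ^ 2 * β l ^ 2) fun n => ?_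
    · have := hβ.pos l
      positivity
    · refine (le_add_self.trans (hsum n)).trans (ENNReal.ofReal_le_ofReal ?_)
      have := (hβ.summable_sq.mul_left (2 * L * G ^ 2)).sum_le_tsum (Finset.range n)
        fun l _ => by positivity
      linarith
  filter_upwards [measure_eq_zero_iff_ae_notMem.1 hN0] with ω hω hωA
  by_contra hne
  refine hω ⟨hωA, fun l => ?_⟩
  by_contra hlt
  exact hne ⟨l, not_le.1 hlt⟩

end SearchStops

/-! ### Past and fresh samples along the saddle search. -/

namespace SaddleSearch

variable {d k : ℕ} {S : Type*} [MeasurableSpace S]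

/-- Indices of the samples that determine the `n`-th iterate. -/
def outerPast (k n : ℕ) : Set (SampleIdx k) :=
  {i | Sum.elim (fun a => a < n) (fun q => q.1 < n) i}

/-- Indices of the samples drawn before inner step `l` of the search for direction `j` after the
`n`-th update. -/
def innerPast (n : ℕ) (j : Fin k) (l : ℕ) : Set (SampleIdx k) :=
  {i | Sum.elim (fun a => a ≤ n)
    (fun q => q.1 < n ∨ (q.1 = n ∧ (q.2.1 < j ∨ (q.2.1 = j ∧ q.2.2 < l)))) i}

theorem outerPast_subset_innerPast (n : ℕ) (j : Fin k) (l : ℕ) :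
    outerPast k n ⊆ innerPast n j l := by
  rintro (i | q) hi
  · exact le_of_lt (show i < n from hi)
  · exact Or.inl hi

section Measurability

variable {Ω : Type*} [MeasurableSpace Ω] (a : SaddleSearch d S) (x₀ : Vec d)
  (v₀ : Fin k → Vec d)

theorem measurable_run_succ_fst (hg : Measurable (Function.uncurry a.g))
    {Z : SampleIdx k → Ω → S} {n : ℕ}
    (hrun : Measurable fun ω => a.run x₀ v₀ (fun i => Z i ω) n)
    (hZ : Measurable (Z (Sum.inl n))) :
    Measurable fun ω => (a.run x₀ v₀ (fun i => Z i ω) (n + 1)).1 := by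
  have hG : Measurable fun ω => a.g (a.run x₀ v₀ (fun i => Z i ω) n).1 (Z (Sum.inl n) ω) :=
    hg.comp (hrun.fst.prodMk hZ)
  exact hrun.fst.fun_sub ((measurable_reflect hrun.snd hG).fun_const_smul (a.α n))

theorem measurable_run (hg : Measurable (Function.uncurry a.g))
    (hh : Measurable (Function.uncurry a.h)) (hH : Measurable (hessian a.f))
    {Z : SampleIdx k → Ω → S} (n : ℕ) (hZ : ∀ i ∈ outerPast k n, Measurable (Z i)) :
    Measurable fun ω => a.run x₀ v₀ (fun i => Z i ω) n := by
  induction n with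
  | zero => exact measurable_const
  | succ n ih =>
    have hrun := ih fun i hi => hZ i (by
      rcases i with i | q
      · exact Nat.lt_succ_of_lt hi
      · exact Nat.lt_succ_of_lt hi)
    have hx := measurable_run_succ_fst a x₀ v₀ hg hrun (hZ _ (Nat.lt_succ_self n))
    refine hx.prodMk ?_
    exact measurable_searchUpTo (A := fun j l ω => a.h (a.run x₀ v₀ (fun i => Z i ω) (n + 1)).1
      (Z (Sum.inr (n, j, l)) ω)) (hH.comp hx) hrun.snd a.tol a.β k
      fun i _ l => hh.comp (hx.prodMk (hZ _ (Nat.lt_succ_self n)))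

end Measurability

/-- The search at a point of `B` stops almost surely. -/
theorem ae_stopsAt {Ω : Type*} [MeasurableSpace Ω] {P : Measure Ω} [IsProbabilityMeasure P]
    {ν : Measure S} [IsProbabilityMeasure ν] (a : SaddleSearch d S) (x₀ : Vec d)
    (v₀ : Fin k → Vec d) {Z : SampleIdx k → Ω → S} (hind : iIndepFun Z P)
    (hZ : ∀ i, MeasurePreserving (Z i) P ν) (hg : Measurable (Function.uncurry a.g))
    {σ G L μ : ℝ} {B : Set (Vec d)} (hB : MeasurableSet B)
    (hh : UnbiasedHessian a.f a.h ν σ G B)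
    (hgap : ∀ x ∈ B, SpectralGap (hessian a.f x) k L μ)
    (hH : Measurable (hessian a.f)) (hL : 0 ≤ L) (htol : 0 < a.tol)
    (hβ : DecayStepSize a.β) (n : ℕ) :
    ∀ᵐ ω ∂P, (a.run x₀ v₀ (fun i => Z i ω) (n + 1)).1 ∈ B →
      a.StopsAt x₀ v₀ (fun i => Z i ω) n := by
  have hZm : ∀ i, Measurable (Z i) := fun i => (hZ i).measurable
  have hrun : ∀ j l, Measurable[sampleSigma Z (innerPast n j l)]
      -- The measurability lemma is applied with the `σ`-algebra of the past as the measurable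
      -- structure on `Ω`.
      fun ω => a.run x₀ v₀ (fun i => Z i ω) n := fun j l =>
    @measurable_run d k S _ Ω (sampleSigma Z (innerPast n j l)) a x₀ v₀ hg hh.measurable hH Z n
      fun i hi => measurable_sampleSigma (outerPast_subset_innerPast n j l hi)
  have hx : ∀ j l, Measurable[sampleSigma Z (innerPast n j l)]
      fun ω => (a.run x₀ v₀ (fun i => Z i ω) (n + 1)).1 := fun j l =>
    @measurable_run_succ_fst d k S _ Ω (sampleSigma Z (innerPast n j l)) a x₀ v₀ hg Z n (hrun j l)
      (measurable_sampleSigma (le_refl n))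
  have hj : ∀ j : Fin k, ∀ᵐ ω ∂P, (a.run x₀ v₀ (fun i => Z i ω) (n + 1)).1 ∈ B →
      (stopTimes (hessian a.f (a.run x₀ v₀ (fun i => Z i ω) (n + 1)).1) a.tol
        (fun l => a.h (a.run x₀ v₀ (fun i => Z i ω) (n + 1)).1 (Z (Sum.inr (n, j, l)) ω)) a.β
        (searchUpTo (hessian a.f (a.run x₀ v₀ (fun i => Z i ω) (n + 1)).1) a.tol
          (a.hessSamples (fun i => Z i ω) n (a.run x₀ v₀ (fun i => Z i ω) (n + 1)).1) a.β
          (a.run x₀ v₀ (fun i => Z i ω) n).2 j) j).Nonempty := by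
    intro j
    refine ae_stopTimes_nonempty (m := fun l => sampleSigma Z (innerPast n j l))
      (Y := fun l => Z (Sum.inr (n, j, l)))
      (x := fun ω => (a.run x₀ v₀ (fun i => Z i ω) (n + 1)).1)
      (v := fun ω => searchUpTo (hessian a.f (a.run x₀ v₀ (fun i => Z i ω) (n + 1)).1) a.tol
          (a.hessSamples (fun i => Z i ω) n (a.run x₀ v₀ (fun i => Z i ω) (n + 1)).1) a.β
          (a.run x₀ v₀ (fun i => Z i ω) n).2 j)
      (A := {ω | (a.run x₀ v₀ (fun i => Z i ω) (n + 1)).1 ∈ B})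
      (fun l => sampleSigma_le hZm _) (fun l => hZ _)
      (fun l => indep_sampleSigma hZm hind ?_) (fun l i hi => measurable_sampleSigma ?_) hh hgap hH
      hL htol hβ (hx j) (fun l => ?_) (fun ω => subOrthonormal_Iio_searchUpTo _ _ _ _ _ _)
      (fun l => hx j l hB) (fun ω hω => hω)
    · simp [innerPast]
    · exact Or.inr ⟨rfl, Or.inr ⟨rfl, hi⟩⟩
    · exact @measurable_searchUpTo Ω (sampleSigma Z (innerPast n j l)) d k
        (fun ω => hessian a.f (a.run x₀ v₀ (fun i => Z i ω) (n + 1)).1)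
        (fun i l ω => a.h (a.run x₀ v₀ (fun i => Z i ω) (n + 1)).1 (Z (Sum.inr (n, i, l)) ω))
        (fun ω => (a.run x₀ v₀ (fun i => Z i ω) n).2) (hH.comp (hx j l))
        (measurable_snd.comp (hrun j l)) a.tol a.β j fun i hi l' =>
          hh.measurable.comp ((hx j l).prodMk
            (measurable_sampleSigma (Or.inr ⟨rfl, Or.inl hi⟩)))
  filter_upwards [ae_all_iff.2 hj] with ω hω hB j using hω j hB

end SaddleSearch

/-! ### Gradient estimates near the stationary point -/

section Gradient

variable {d k : ℕ} {f : Vec d → ℝ}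

theorem contDiff_gradient (hf : ContDiff ℝ 3 f) : ContDiff ℝ 2 (gradient f) := by
  have h1 : ContDiff ℝ 2 (fderiv ℝ f) := hf.fderiv_right (by norm_num)
  exact (InnerProductSpace.toDual ℝ (Vec d)).symm.toContinuousLinearEquiv.contDiff.comp h1

theorem continuous_hessian (hf : ContDiff ℝ 3 f) : Continuous (hessian f) :=
  (contDiff_gradient hf).continuous_fderiv (by norm_num)

theorem hasFDerivAt_gradient (hf : ContDiff ℝ 3 f) (x : Vec d) :
    HasFDerivAt (gradient f) (hessian f x) x :=
  ((contDiff_gradient hf).differentiable (by norm_num) x).hasFDerivAt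

variable {xs x : Vec d} {δ L μ M : ℝ}

theorem norm_gradient_le (hf : ContDiff ℝ 3 f) (hxs : gradient f xs = 0)
    (hH : HessianAssumption f xs k δ L μ M) (hL : 0 ≤ L) (hδ : 0 ≤ δ)
    (hx : x ∈ Metric.closedBall xs δ) : ‖gradient f x‖ ≤ L * ‖x - xs‖ := by
  have h := (convex_closedBall xs δ).norm_image_sub_le_of_norm_hasFDerivWithin_le
    (fun y _ => (hasFDerivAt_gradient hf y).hasFDerivWithinAt)
    (fun y hy => (hH.gap y hy).norm_le hL) (Metric.mem_closedBall_self hδ) hx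
  rwa [hxs, sub_zero] at h

theorem norm_gradient_sub_le (hf : ContDiff ℝ 3 f) (hxs : gradient f xs = 0)
    (hH : HessianAssumption f xs k δ L μ M) (hM : 0 ≤ M) (hδ : 0 ≤ δ)
    (hx : x ∈ Metric.closedBall xs δ) :
    ‖gradient f x - hessian f x (x - xs)‖ ≤ M * ‖x - xs‖ * ‖x - xs‖ := by
  -- On the part of the `δ`-ball within distance `‖x - xs‖` of `x`, the Hessian differs from its
  -- value at `x` by at most `M‖x - xs‖`. This convex set contains both endpoints, so the mean value
  -- inequality applies.
  have h := ((convex_closedBall xs δ).inter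
      (convex_closedBall x ‖x - xs‖)).norm_image_sub_le_of_norm_hasFDerivWithin_le'
    (f := gradient f) (C := M * ‖x - xs‖) (φ := hessian f x)
    (fun y _ => (hasFDerivAt_gradient hf y).hasFDerivWithinAt)
    (fun y hy => (hH.lipschitz y hy.1 x hx).trans
      (mul_le_mul_of_nonneg_left (by simpa [dist_eq_norm] using hy.2) hM))
    (x := xs) (y := x)
    ⟨Metric.mem_closedBall_self hδ, by simp [dist_eq_norm, norm_sub_rev]⟩
    ⟨hx, Metric.mem_closedBall_self (norm_nonneg _)⟩
  rwa [hxs, sub_zero] at h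

namespace SaddleSearch

theorem reflect_add (v : Fin k → Vec d) (x y : Vec d) :
    reflect v (x + y) = reflect v x + reflect v y := by
  simp only [reflect, inner_add_right, add_smul, Finset.sum_add_distrib, smul_add]
  abel

/-- The reflection preserves norms, so the Taylor remainder changes the inner product by at most
`M‖x - xs‖³`, which is at most `c‖x - xs‖²` within radius `c / M`. -/
theorem le_inner_reflect_gradient (hf : ContDiff ℝ 3 f) (hxs : gradient f xs = 0)
    (hH : HessianAssumption f xs k δ L μ M) (hM : 0 < M) (hδ : 0 ≤ δ)
    (hx : x ∈ Metric.closedBall xs δ) {v : Fin k → Vec d} (hv : SubOrthonormal Finset.univ v)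
    {c₀ c : ℝ} (hxr : ‖x - xs‖ ≤ c / M)
    (hc : c₀ * ‖x - xs‖ ^ 2 ≤ inner ℝ (x - xs) (reflect v (hessian f x (x - xs)))) :
    (c₀ - c) * ‖x - xs‖ ^ 2 ≤ inner ℝ (x - xs) (reflect v (gradient f x)) := by
  have h1 := norm_gradient_sub_le hf hxs hH hM.le hδ hx
  have h2 : gradient f x =
      hessian f x (x - xs) + (gradient f x - hessian f x (x - xs)) := by abel
  rw [h2, reflect_add, inner_add_right]
  have h3 := (abs_le.1 (abs_real_inner_le_norm (x - xs)
    (reflect v (gradient f x - hessian f x (x - xs))))).1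
  rw [norm_reflect hv] at h3
  rw [le_div_iff₀ hM] at hxr
  have h4 := mul_le_mul_of_nonneg_right hxr (sq_nonneg ‖x - xs‖)
  nlinarith [mul_le_mul_of_nonneg_left h1 (norm_nonneg (x - xs))]

end SaddleSearch

end Gradient

/-! ### The squared distance to a ball -/

section BallExcess

variable {V : Type*} [NormedAddCommGroup V]

/-- The squared distance of `x` to the closed ball of radius `ρ` around `c`. -/
noncomputable def sqDistBall (c : V) (ρ : ℝ) (x : V) : ℝ := max (‖x - c‖ - ρ) 0 ^ 2

theorem sqDistBall_eq_zero {c x : V} {ρ : ℝ} (hx : ‖x - c‖ ≤ ρ) : sqDistBall c ρ x = 0 := by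
  rw [sqDistBall, max_eq_right (by linarith)]
  norm_num

theorem sqDistBall_le {c y : V} {ρ : ℝ} (hy : ‖y - c‖ ≤ ρ) (x : V) :
    sqDistBall c ρ x ≤ ‖x - y‖ ^ 2 := by
  refine pow_le_pow_left₀ (le_max_right _ _) (max_le ?_ (norm_nonneg _)) 2
  have := norm_add_le (x - y) (y - c)
  rw [sub_add_sub_cancel] at this
  linarith

theorem le_sqDistBall {c x : V} {ρ r : ℝ} (hρ : ρ ≤ r) (hx : r ≤ ‖x - c‖) :
    (r - ρ) ^ 2 ≤ sqDistBall c ρ x :=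
  pow_le_pow_left₀ (by linarith) ((by linarith : r - ρ ≤ ‖x - c‖ - ρ).trans (le_max_left _ _)) 2

/-- The displacement from the nearest point of the ball is a nonnegative multiple of `x - c`, so a
descent inequality relative to the centre also holds relative to that point. -/
theorem exists_proj_ball [NormedSpace ℝ V] (c x : V) {ρ : ℝ} (hρ : 0 ≤ ρ) :
    ∃ (y : V) (t : ℝ), 0 ≤ t ∧ ‖y - c‖ ≤ ρ ∧ x - y = t • (x - c) ∧ ‖x - y‖ ^ 2 = sqDistBall c ρ x := by
  rcases le_or_gt ‖x - c‖ ρ with h | h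
  · exact ⟨x, 0, le_rfl, h, by simp, by simp [sqDistBall_eq_zero h]⟩
  · have h0 : 0 < ‖x - c‖ := hρ.trans_lt h
    have ht : 0 ≤ 1 - ρ / ‖x - c‖ := by
      rw [sub_nonneg, div_le_one h0]
      exact h.le
    have hxy : x - (c + (ρ / ‖x - c‖) • (x - c)) = (1 - ρ / ‖x - c‖) • (x - c) := by
      rw [sub_smul, one_smul]
      abel
    refine ⟨c + (ρ / ‖x - c‖) • (x - c), 1 - ρ / ‖x - c‖, ht, ?_, hxy, ?_⟩
    · rw [add_sub_cancel_left, norm_smul, Real.norm_of_nonneg (by positivity),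
        div_mul_cancel₀ _ h0.ne']
    · rw [hxy, norm_smul, Real.norm_of_nonneg ht, sqDistBall, max_eq_left (by linarith), sub_mul,
        one_mul, div_mul_cancel₀ _ h0.ne']

end BallExcess

/-! ### Stochastic reflected gradient descent -/

section Descent

variable {d k : ℕ} {S : Type*} [MeasurableSpace S] {ν : Measure S}
  {f : Vec d → ℝ} {g : Vec d → S → Vec d} {σ : ℝ}

open SaddleSearch in
theorem lintegral_reflect_step_le [IsProbabilityMeasure ν] (hg : UnbiasedGradient f g ν σ) {v : Fin k → Vec d}
    (hv : SubOrthonormal Finset.univ v) (x y : Vec d) (α : ℝ) {G : ℝ}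
    (hG : ‖gradient f x‖ ^ 2 + σ ^ 2 ≤ G) :
    ∫⁻ s, ENNReal.ofReal (‖x - α • reflect v (g x s) - y‖ ^ 2) ∂ν ≤
      ENNReal.ofReal
        (‖x - y‖ ^ 2 - 2 * α * inner ℝ (x - y) (reflect v (gradient f x)) + α ^ 2 * G) := by
  -- `‖g‖²` is expanded around the mean gradient, so that only the integrable quantities of
  -- `UnbiasedGradient` occur.
  have hpt : ∀ s, ‖x - α • reflect v (g x s) - y‖ ^ 2 =
      ‖x - y‖ ^ 2 - α ^ 2 * ‖gradient f x‖ ^ 2 - 2 * α * inner ℝ (reflect v (x - y)) (g x s) +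
        2 * α ^ 2 * inner ℝ (gradient f x) (g x s) + α ^ 2 * ‖g x s - gradient f x‖ ^ 2 := by
    intro s
    rw [sub_right_comm, norm_sub_sq_real, inner_smul_right, inner_reflect, norm_smul,
      norm_reflect hv, mul_pow, Real.norm_eq_abs, sq_abs, norm_sub_sq_real (g x s),
      real_inner_comm (g x s) (gradient f x)]
    ring
  have i1 := (integrable_const (μ := ν) (‖x - y‖ ^ 2 - α ^ 2 * ‖gradient f x‖ ^ 2))
  have i2 := ((hg.integrable x).const_inner (𝕜 := ℝ) (reflect v (x - y))).const_mul (2 * α)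
  have i3 := ((hg.integrable x).const_inner (𝕜 := ℝ) (gradient f x)).const_mul (2 * α ^ 2)
  have i4 := (hg.integrable_sq x).const_mul (α ^ 2)
  have i12 : Integrable (fun s => ‖x - y‖ ^ 2 - α ^ 2 * ‖gradient f x‖ ^ 2 -
      2 * α * inner ℝ (reflect v (x - y)) (g x s)) ν := i1.sub i2
  have i123 : Integrable (fun s => ‖x - y‖ ^ 2 - α ^ 2 * ‖gradient f x‖ ^ 2 -
      2 * α * inner ℝ (reflect v (x - y)) (g x s) +
        2 * α ^ 2 * inner ℝ (gradient f x) (g x s)) ν := i12.add i3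
  rw [← ofReal_integral_eq_lintegral_ofReal]
  · refine ENNReal.ofReal_le_ofReal ?_
    simp only [hpt]
    rw [integral_add i123 i4, integral_add i12 i3, integral_sub i1 i2,
      integral_const_mul, integral_const_mul, integral_const_mul, integral_inner (hg.integrable x),
      integral_inner (hg.integrable x), hg.mean, inner_reflect, real_inner_self_eq_norm_sq]
    simp only [integral_const, probReal_univ, one_smul]
    nlinarith [mul_le_mul_of_nonneg_left (hg.variance x) (sq_nonneg α),
      mul_le_mul_of_nonneg_left hG (sq_nonneg α)]
  · simp only [hpt]
    exact i123.add i4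
  · exact Eventually.of_forall fun s => sq_nonneg _

/-- The process `x (n+1) = x n - α n • (I - 2 ∑ v_i v_iᵀ) g (x n) (Y n)` with reflections `v n`
that are determined by the past `m n`, and fresh samples `Y n`. -/
structure ReflectedDescent {Ω : Type*} [mΩ : MeasurableSpace Ω] (P : Measure Ω) (ν : Measure S)
    (g : Vec d → S → Vec d) (α : ℕ → ℝ) (m : ℕ → MeasurableSpace Ω) (Y : ℕ → Ω → S)
    (x : ℕ → Ω → Vec d) (v : ℕ → Ω → Fin k → Vec d) : Prop where
  le : ∀ n, m n ≤ mΩ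
  mono : Monotone m
  sample : ∀ n, MeasurePreserving (Y n) P ν
  indep : ∀ n, Indep (m n) (MeasurableSpace.comap (Y n) inferInstance) P
  measurable_fst : ∀ n, Measurable[m n] (x n)
  measurable_snd : ∀ n, Measurable[m n] (v n)
  subOrthonormal : ∀ n ω, SubOrthonormal Finset.univ (v n ω)
  step : ∀ n ω, x (n + 1) ω = x n ω - α n • SaddleSearch.reflect (v n ω) (g (x n ω) (Y n ω))

/-- The event that the process stays in `U` up to time `n`. -/
def stayUpTo {Ω : Type*} (x : ℕ → Ω → Vec d) (U : Set (Vec d)) (n : ℕ) : Set Ω :=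
  {ω | ∀ i ≤ n, x i ω ∈ U}

theorem stayUpTo_succ_subset {Ω : Type*} (x : ℕ → Ω → Vec d) (U : Set (Vec d)) (n : ℕ) :
    stayUpTo x U (n + 1) ⊆ stayUpTo x U n := fun _ hω i hi => hω i (hi.trans (Nat.le_succ n))

theorem antitone_stayUpTo {Ω : Type*} (x : ℕ → Ω → Vec d) (U : Set (Vec d)) :
    Antitone (stayUpTo x U) :=
  antitone_nat_of_succ_le fun n => stayUpTo_succ_subset x U n

theorem iInter_stayUpTo {Ω : Type*} (x : ℕ → Ω → Vec d) (U : Set (Vec d)) :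
    ⋂ n, stayUpTo x U n = {ω | ∀ n, x n ω ∈ U} := by
  ext ω
  simp only [Set.mem_iInter]
  exact ⟨fun h n => h n n le_rfl, fun h n i _ => h i⟩

namespace ReflectedDescent

open SaddleSearch

variable {Ω : Type*} [mΩ : MeasurableSpace Ω] {P : Measure Ω}
  {α : ℕ → ℝ} {m : ℕ → MeasurableSpace Ω} {Y : ℕ → Ω → S} {x : ℕ → Ω → Vec d}
  {v : ℕ → Ω → Fin k → Vec d}

theorem measurable (h : ReflectedDescent P ν g α m Y x v) (n : ℕ) : Measurable (x n) :=
  (h.measurable_fst n).mono (h.le n) le_rfl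

theorem measurableSet_stayUpTo (h : ReflectedDescent P ν g α m Y x v) {U : Set (Vec d)}
    (hU : MeasurableSet U) (n : ℕ) : MeasurableSet[m n] (stayUpTo x U n) := by
  have : stayUpTo x U n = ⋂ i ∈ {i | i ≤ n}, x i ⁻¹' U := by
    ext ω
    simp [stayUpTo]
  rw [this]
  exact MeasurableSet.biInter (Set.to_countable _) fun i hi =>
    h.mono (show i ≤ n from hi) _ (h.measurable_fst i hU)

theorem setLIntegral_step_le [IsProbabilityMeasure P] (h : ReflectedDescent P ν g α m Y x v)
    (hg : Measurable (Function.uncurry g)) {U : Set (Vec d)} (hU : MeasurableSet U) (n : ℕ)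
    {Ψ : Vec d → ℝ} (hΨ : Measurable Ψ) {B : Ω → ENNReal}
    (hB : ∀ᵐ ω ∂P, ω ∈ stayUpTo x U n →
      ∫⁻ s, ENNReal.ofReal (Ψ (x n ω - α n • reflect (v n ω) (g (x n ω) s))) ∂ν ≤ B ω) :
    ∫⁻ ω in stayUpTo x U n, ENNReal.ofReal (Ψ (x (n + 1) ω)) ∂P ≤
      ∫⁻ ω in stayUpTo x U n, B ω ∂P := by
  have hE := h.measurableSet_stayUpTo hU n
  have e1 : Measurable fun q : (Vec d × (Fin k → Vec d)) × S => q.1.1 := by fun_prop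
  have e2 : Measurable fun q : (Vec d × (Fin k → Vec d)) × S => q.1.2 := by fun_prop
  have e3 : Measurable fun q : (Vec d × (Fin k → Vec d)) × S => g q.1.1 q.2 :=
    hg.comp (e1.prodMk _root_.measurable_snd)
  have key := setLIntegral_le_of_indep (h.le n) (x := fun ω => (x n ω, v n ω)) (h.indep n)
    (h.sample n) ((h.measurable_fst n).prodMk (h.measurable_snd n)) hE
    (F := fun q s => ENNReal.ofReal (Ψ (q.1 - α n • reflect q.2 (g q.1 s))))
    (hΨ.comp (e1.fun_sub ((measurable_reflect e2 e3).fun_const_smul (α n)))).ennreal_ofReal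
    (B := B) ((ae_restrict_iff' (h.le n _ hE)).2 hB)
  simpa only [h.step] using key

/-- Bound for the probability of leaving the ball of radius `r` before time `n`. -/
theorem measure_compl_stayUpTo_le [IsProbabilityMeasure ν]
    [IsProbabilityMeasure P] (h : ReflectedDescent P ν g α m Y x v)
    (hg : UnbiasedGradient f g ν σ) {xs : Vec d} {r ρ G : ℝ} (hρ : 0 ≤ ρ) (hρr : ρ ≤ r)
    (hα : ∀ n, 0 ≤ α n) (hx₀ : ∀ ω, ‖x 0 ω - xs‖ ≤ ρ)
    (hG : ∀ y ∈ Metric.closedBall xs r, ‖gradient f y‖ ^ 2 + σ ^ 2 ≤ G)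
    (hdesc : ∀ᵐ ω ∂P, ∀ n, n ≠ 0 → ω ∈ stayUpTo x (Metric.closedBall xs r) n →
      0 ≤ inner ℝ (x n ω - xs) (reflect (v n ω) (gradient f (x n ω)))) (n : ℕ) :
    ENNReal.ofReal ((r - ρ) ^ 2) * P (stayUpTo x (Metric.closedBall xs r) n)ᶜ +
      ∫⁻ ω in stayUpTo x (Metric.closedBall xs r) n, ENNReal.ofReal (sqDistBall xs ρ (x n ω)) ∂P ≤
      ENNReal.ofReal (∑ i ∈ Finset.range n, α i ^ 2 * G) := by
  have hU : MeasurableSet (Metric.closedBall xs r) := Metric.isClosed_closedBall.measurableSet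
  have hEm : ∀ n, MeasurableSet (stayUpTo x (Metric.closedBall xs r) n) := fun n =>
    h.le n _ (h.measurableSet_stayUpTo hU n)
  set E := stayUpTo x (Metric.closedBall xs r) with hE
  have hG0 : 0 ≤ G := (by positivity : (0 : ℝ) ≤ ‖gradient f xs‖ ^ 2 + σ ^ 2).trans
    (hG xs (Metric.mem_closedBall_self (hρ.trans hρr)))
  have hΨ : Measurable (sqDistBall xs ρ) := by
    unfold sqDistBall
    fun_prop
  induction n with
  | zero =>
    have h0 : E 0 = Set.univ := by
      refine Set.eq_univ_of_forall fun ω i hi => ?_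
      rw [Nat.le_zero.1 hi, Metric.mem_closedBall, dist_eq_norm]
      exact (hx₀ ω).trans hρr
    simp [h0, sqDistBall_eq_zero (hx₀ _)]
  | succ n ih =>
    have hstep : ∫⁻ ω in E n, ENNReal.ofReal (sqDistBall xs ρ (x (n + 1) ω)) ∂P ≤
        ∫⁻ ω in E n, ENNReal.ofReal (sqDistBall xs ρ (x n ω) + α n ^ 2 * G) ∂P := by
      refine h.setLIntegral_step_le hg.measurable hU n hΨ ?_
      filter_upwards [hdesc] with ω hω hωE
      obtain ⟨y, t, ht, hy, hxy, hsq⟩ := exists_proj_ball xs (x n ω) hρ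
      refine (lintegral_mono fun s => ENNReal.ofReal_le_ofReal (sqDistBall_le hy _)).trans ?_
      refine (lintegral_reflect_step_le hg (h.subOrthonormal n ω) (x n ω) y (α n)
        (hG _ (hωE n le_rfl))).trans (ENNReal.ofReal_le_ofReal ?_)
      -- At `n = 0` the frame is arbitrary, but the starting point lies in the small ball and `x 0 -
      -- y = 0`.
      have hin : 0 ≤ inner ℝ (x n ω - y) (reflect (v n ω) (gradient f (x n ω))) := by
        rcases eq_or_ne n 0 with rfl | hn
        · rw [sqDistBall_eq_zero (hx₀ ω), sq_eq_zero_iff, norm_eq_zero] at hsq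
          simp [hsq]
        · rw [hxy, real_inner_smul_left]
          exact mul_nonneg ht (hω n hn hωE)
      rw [hsq]
      nlinarith [mul_nonneg (hα n) hin]
    have hright : ∫⁻ ω in E n, ENNReal.ofReal (sqDistBall xs ρ (x n ω) + α n ^ 2 * G) ∂P ≤
        ∫⁻ ω in E n, ENNReal.ofReal (sqDistBall xs ρ (x n ω)) ∂P +
          ENNReal.ofReal (α n ^ 2 * G) := by
      refine (lintegral_mono fun ω => ENNReal.ofReal_add_le).trans ?_
      rw [lintegral_add_right _ measurable_const, setLIntegral_const]
      exact add_le_add le_rfl (mul_le_of_le_one_right zero_le prob_le_one)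
    have hsub : E (n + 1) ⊆ E n := stayUpTo_succ_subset _ _ _
    -- Paths that leave exactly at step `n + 1` have squared distance at least `(r - ρ)²` from the
    -- small ball; this pays for the growth of the escape probability.
    have hleft : ∫⁻ ω in E (n + 1), ENNReal.ofReal (sqDistBall xs ρ (x (n + 1) ω)) ∂P +
        ENNReal.ofReal ((r - ρ) ^ 2) * P (E n \ E (n + 1)) ≤
        ∫⁻ ω in E n, ENNReal.ofReal (sqDistBall xs ρ (x (n + 1) ω)) ∂P := by
      have hun : E n = E (n + 1) ∪ (E n \ E (n + 1)) := (Set.union_sdiff_cancel hsub).symm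
      conv_rhs => rw [hun]
      rw [lintegral_union ((hEm n).diff (hEm (n + 1))) Set.disjoint_sdiff_right]
      refine add_le_add le_rfl ?_
      rw [← setLIntegral_const]
      refine setLIntegral_mono' ((hEm n).diff (hEm (n + 1))) fun ω hω =>
        ENNReal.ofReal_le_ofReal (le_sqDistBall hρr ?_)
      by_contra hlt
      refine hω.2 fun i hi => ?_
      rcases Nat.le_succ_iff.1 hi with hi | rfl
      · exact hω.1 i hi
      · rw [Metric.mem_closedBall, dist_eq_norm]
        exact (not_le.1 hlt).le
    have hcompl : P (E (n + 1))ᶜ ≤ P (E n)ᶜ + P (E n \ E (n + 1)) := by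
      refine (measure_mono fun ω hω => ?_).trans (measure_union_le _ _)
      by_cases hωn : ω ∈ E n
      · exact Or.inr ⟨hωn, hω⟩
      · exact Or.inl hωn
    rw [Finset.sum_range_succ, ENNReal.ofReal_add (Finset.sum_nonneg fun i _ => by positivity)
      (by positivity)]
    calc _ ≤ ENNReal.ofReal ((r - ρ) ^ 2) * P (E n)ᶜ +
          (∫⁻ ω in E (n + 1), ENNReal.ofReal (sqDistBall xs ρ (x (n + 1) ω)) ∂P +
            ENNReal.ofReal ((r - ρ) ^ 2) * P (E n \ E (n + 1))) := by
          refine (add_le_add (mul_le_mul_right hcompl _) le_rfl).trans (le_of_eq ?_)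
          rw [mul_add, add_assoc, add_comm (_ * P (E n \ E (n + 1)))]
      _ ≤ ENNReal.ofReal ((r - ρ) ^ 2) * P (E n)ᶜ +
          (∫⁻ ω in E n, ENNReal.ofReal (sqDistBall xs ρ (x n ω)) ∂P +
            ENNReal.ofReal (α n ^ 2 * G)) :=
          add_le_add le_rfl (hleft.trans (hstep.trans hright))
      _ ≤ _ := by
          rw [← add_assoc]
          exact add_le_add ih le_rfl

theorem rate_step_le {q s K g : ℝ} (hq : 2 ≤ q) (hs : 1 ≤ s) (hK : 0 ≤ K) (hg : g ≤ K) :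
    (1 - q / s) * (K / s) + g / s ^ 2 ≤ K / (s + 1) := by
  have hs0 : 0 < s := by linarith
  have h1 : (1 - q / s) * (K / s) + g / s ^ 2 = ((s - q) * K + g) / s ^ 2 := by
    field_simp
  rw [h1, div_le_div_iff₀ (by positivity) (by positivity)]
  nlinarith [mul_nonneg hK (by linarith : (0 : ℝ) ≤ q - 2), mul_nonneg (mul_nonneg hK hs0.le)
    (by linarith : (0 : ℝ) ≤ q - 2)]

/-- Mean squared distance to the stationary point on the event of staying in the ball. -/
theorem setLIntegral_sq_le [IsProbabilityMeasure ν]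
    [IsProbabilityMeasure P] (h : ReflectedDescent P ν g α m Y x v)
    (hg : UnbiasedGradient f g ν σ) {xs : Vec d} {r G γ κ t K : ℝ} (hr : 0 ≤ r)
    (hα : ∀ n : ℕ, α n = γ / (n + t)) (hγ : 0 ≤ γ) (ht : 1 ≤ t) (hγκ : 2 ≤ 2 * κ * γ)
    (hκt : 2 * κ * γ ≤ t) (hK1 : r ^ 2 * (1 + t) ≤ K) (hK2 : γ ^ 2 * G ≤ K)
    (hG : ∀ y ∈ Metric.closedBall xs r, ‖gradient f y‖ ^ 2 + σ ^ 2 ≤ G)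
    (hdesc : ∀ᵐ ω ∂P, ∀ n, n ≠ 0 → ω ∈ stayUpTo x (Metric.closedBall xs r) n →
      κ * ‖x n ω - xs‖ ^ 2 ≤ inner ℝ (x n ω - xs) (reflect (v n ω) (gradient f (x n ω))))
    (n : ℕ) :
    ∫⁻ ω in stayUpTo x (Metric.closedBall xs r) n, ENNReal.ofReal (‖x n ω - xs‖ ^ 2) ∂P ≤
      ENNReal.ofReal (K / (n + t)) := by
  have hU : MeasurableSet (Metric.closedBall xs r) := Metric.isClosed_closedBall.measurableSet
  have hEm : ∀ n, MeasurableSet (stayUpTo x (Metric.closedBall xs r) n) := fun n =>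
    h.le n _ (h.measurableSet_stayUpTo hU n)
  set E := stayUpTo x (Metric.closedBall xs r) with hE
  have hK0 : 0 ≤ K := le_trans (by positivity) hK1
  -- Both `n = 0` and `n = 1` use the trivial bound `r²`, since step `0` gives no contraction.
  have hbase : ∀ n : ℕ, n ≤ 1 → ∫⁻ ω in E n, ENNReal.ofReal (‖x n ω - xs‖ ^ 2) ∂P ≤
      ENNReal.ofReal (K / (n + t)) := by
    intro n hn
    have hn' : (n : ℝ) ≤ 1 := by exact_mod_cast hn
    calc ∫⁻ ω in E n, ENNReal.ofReal (‖x n ω - xs‖ ^ 2) ∂P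
        ≤ ∫⁻ ω in E n, ENNReal.ofReal (r ^ 2) ∂P := by
          refine setLIntegral_mono' (hEm n) fun ω hω => ENNReal.ofReal_le_ofReal ?_
          have := hω n le_rfl
          rw [Metric.mem_closedBall, dist_eq_norm] at this
          exact pow_le_pow_left₀ (norm_nonneg _) this 2
      _ ≤ ENNReal.ofReal (r ^ 2) := by
          rw [setLIntegral_const]
          exact mul_le_of_le_one_right zero_le prob_le_one
      _ ≤ _ := by
          refine ENNReal.ofReal_le_ofReal ?_
          rw [le_div_iff₀ (by positivity)]
          exact (mul_le_mul_of_nonneg_left (by linarith) (sq_nonneg r)).trans hK1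
  induction n with
  | zero => exact hbase 0 (by norm_num)
  | succ n ih =>
    rcases eq_or_ne n 0 with rfl | hn
    · exact hbase 1 le_rfl
    set s : ℝ := n + t with hs
    have hs1 : 1 ≤ s := by
      have : (0 : ℝ) ≤ n := Nat.cast_nonneg n
      linarith
    have hts : t ≤ s := by
      have : (0 : ℝ) ≤ n := Nat.cast_nonneg n
      linarith
    have hs0 : 0 < s := by linarith
    have hq : 0 ≤ 1 - 2 * κ * γ / s := by
      rw [sub_nonneg, div_le_one hs0]
      linarith
    have hG0 : 0 ≤ G := (by positivity : (0 : ℝ) ≤ ‖gradient f xs‖ ^ 2 + σ ^ 2).trans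
      (hG xs (Metric.mem_closedBall_self hr))
    have hstep : ∫⁻ ω in E n, ENNReal.ofReal (‖x (n + 1) ω - xs‖ ^ 2) ∂P ≤
        ∫⁻ ω in E n, (ENNReal.ofReal (1 - 2 * κ * γ / s) * ENNReal.ofReal (‖x n ω - xs‖ ^ 2) +
          ENNReal.ofReal (γ ^ 2 * G / s ^ 2)) ∂P := by
      refine h.setLIntegral_step_le hg.measurable hU n (Ψ := fun y => ‖y - xs‖ ^ 2)
        (by fun_prop) ?_
      filter_upwards [hdesc] with ω hω hωE
      refine (lintegral_reflect_step_le hg (h.subOrthonormal n ω) (x n ω) xs (α n)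
        (hG _ (hωE n le_rfl))).trans ?_
      rw [← ENNReal.ofReal_mul hq, ← ENNReal.ofReal_add (mul_nonneg hq (sq_nonneg _))
        (by positivity)]
      refine ENNReal.ofReal_le_ofReal ?_
      have h1 := mul_le_mul_of_nonneg_left (hω n hn hωE) (by positivity : 0 ≤ 2 * (γ / s))
      rw [hα, ← hs]
      have h2 : 2 * κ * γ / s * ‖x n ω - xs‖ ^ 2 = 2 * (γ / s) * (κ * ‖x n ω - xs‖ ^ 2) := by
        ring
      have h3 : (γ / s) ^ 2 * G = γ ^ 2 * G / s ^ 2 := by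
        rw [div_pow, div_mul_eq_mul_div]
      rw [h3, sub_mul, one_mul, h2]
      linarith
    calc ∫⁻ ω in E (n + 1), ENNReal.ofReal (‖x (n + 1) ω - xs‖ ^ 2) ∂P
        ≤ ∫⁻ ω in E n, ENNReal.ofReal (‖x (n + 1) ω - xs‖ ^ 2) ∂P :=
          lintegral_mono_set (stayUpTo_succ_subset _ _ _)
      _ ≤ _ := hstep
      _ = ENNReal.ofReal (1 - 2 * κ * γ / s) * ∫⁻ ω in E n, ENNReal.ofReal (‖x n ω - xs‖ ^ 2) ∂P +
          ENNReal.ofReal (γ ^ 2 * G / s ^ 2) * P (E n) := by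
          rw [lintegral_add_right _ measurable_const, setLIntegral_const,
            lintegral_const_mul' _ _ ENNReal.ofReal_ne_top]
      _ ≤ ENNReal.ofReal (1 - 2 * κ * γ / s) * ENNReal.ofReal (K / s) +
          ENNReal.ofReal (γ ^ 2 * G / s ^ 2) :=
          add_le_add (mul_le_mul_right ih _) (mul_le_of_le_one_right zero_le prob_le_one)
      _ = ENNReal.ofReal ((1 - 2 * κ * γ / s) * (K / s) + γ ^ 2 * G / s ^ 2) := by
          rw [← ENNReal.ofReal_mul hq, ← ENNReal.ofReal_add (by positivity) (by positivity)]
      _ ≤ _ := by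
          refine ENNReal.ofReal_le_ofReal ((rate_step_le hγκ hs1 hK0 hK2).trans (le_of_eq ?_))
          rw [hs]
          push_cast
          rw [add_right_comm]

end ReflectedDescent

end Descent

/-! ### The constants -/

section Constants

/-- `Δ = 0` must be excluded: the minimum would be zero and `1 / 0 = 0` would give no bound. `Δ = ∞`
is harmless, as the minimum with `μ²` is finite. -/
theorem inv_sq_le_constQ {Δ : ENNReal} {L μ : ℝ} (hΔ : Δ ≠ 0) (hμ : 0 < μ) :
    1 / μ ^ 2 ≤ constQ Δ L μ := by
  refine le_trans ?_ ((le_max_left _ _).trans (le_max_right _ _))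
  have hμ2 : ENNReal.ofReal μ ^ 2 = ENNReal.ofReal (μ ^ 2) := (ENNReal.ofReal_pow hμ.le 2).symm
  have hfin : min (Δ ^ 2 / 4) (ENNReal.ofReal μ ^ 2) ≠ ⊤ :=
    ((min_le_right _ _).trans_lt (by rw [hμ2]; exact ENNReal.ofReal_lt_top)).ne
  refine one_div_le_one_div_of_le (ENNReal.toReal_pos ?_ hfin) ?_
  · rw [← pos_iff_ne_zero, lt_min_iff]
    refine ⟨ENNReal.div_pos (pow_ne_zero 2 hΔ) (by norm_num), ?_⟩
    rw [hμ2]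
    exact ENNReal.ofReal_pos.2 (by positivity)
  · refine ENNReal.toReal_le_of_le_ofReal (by positivity) ?_
    rw [← hμ2]
    exact min_le_right _ _

/-- In `θ = k (L²Q)^k (k!)² ε_v` one has `L²Q ≥ 1`, hence `(L²Q)^k ≥ L²Q ≥ L²/μ²`, and `(k!)² ≥ k`.
-/
theorem theta_bounds {d k : ℕ} (hk : 1 ≤ k) (hd : 0 < d) {Δ : ENNReal} (hΔ : Δ ≠ 0)
    {L μ εv : ℝ} (hL : 0 < L) (hμ : 0 < μ) (hεv : 0 < εv) :
    0 < (k : ℝ) * zbar d k L (constQ Δ L μ) εv ^ 2 * d ∧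
      (k : ℝ) ^ 2 * (L ^ 2 * εv) / μ ^ 2 ≤ k * zbar d k L (constQ Δ L μ) εv ^ 2 * d := by
  set Q := constQ Δ L μ with hQ
  have hQ1 : 1 ≤ Q := le_max_left _ _
  have hQμ : 1 / μ ^ 2 ≤ Q := inv_sq_le_constQ hΔ hμ
  have hQL : 1 / L ^ 2 ≤ Q := (le_max_right _ _).trans (le_max_right _ _)
  have hd' : (0 : ℝ) < d := by exact_mod_cast hd
  have hk' : (0 : ℝ) < k := by exact_mod_cast hk
  have hQ0 : 0 < Q := by linarith
  have hfac : (k : ℝ) ≤ k.factorial := by exact_mod_cast Nat.self_le_factorial k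
  have hfac1 : (1 : ℝ) ≤ k.factorial := by exact_mod_cast Nat.factorial_pos k
  have hz : (k : ℝ) * zbar d k L Q εv ^ 2 * d =
      k * ((L ^ 2 * Q) ^ k * (k.factorial : ℝ) ^ 2 * εv) := by
    rw [zbar, Real.sq_sqrt (by positivity), mul_pow, ← pow_mul]
    field_simp
  rw [hz]
  refine ⟨by positivity, ?_⟩
  have h1 : 1 ≤ L ^ 2 * Q := by
    rw [div_le_iff₀ (by positivity)] at hQL
    linarith
  have h2 : L ^ 2 / μ ^ 2 ≤ (L ^ 2 * Q) ^ k := by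
    refine le_trans ?_ (le_self_pow₀ h1 (by omega))
    rw [div_eq_mul_one_div]
    exact mul_le_mul_of_nonneg_left hQμ (by positivity)
  have h3 : (k : ℝ) ≤ (k.factorial : ℝ) ^ 2 := by nlinarith
  calc (k : ℝ) ^ 2 * (L ^ 2 * εv) / μ ^ 2 = k * (L ^ 2 / μ ^ 2 * k * εv) := by ring
    _ ≤ _ := by
      gcongr

theorem exists_radius {r : ℝ} (hr : 0 < r) :
    ∃ ε : ℝ, 0 < ε ∧ 4 * ε + 2 * √ε = r ^ 2 ∧ √(2 * ε) < r := by
  set q := √(1 + 4 * r ^ 2) with hq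
  have hq2 : q ^ 2 = 1 + 4 * r ^ 2 := Real.sq_sqrt (by positivity)
  have hq1 : 1 < q := by
    rw [hq, Real.lt_sqrt (by norm_num)]
    nlinarith
  -- The positive root of `4s² + 2s = r²`, where `s = √ε`. The inequality for the radius is `2s² <
  -- 4s² + 2s`.
  set s := (q - 1) / 4 with hs
  have hs0 : 0 < s := by
    rw [hs]
    linarith
  have heq : 4 * s ^ 2 + 2 * √(s ^ 2) = r ^ 2 := by
    rw [Real.sqrt_sq hs0.le, hs]
    linarith
  refine ⟨s ^ 2, by positivity, heq, ?_⟩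
  rw [Real.sqrt_lt' hr, ← heq, Real.sqrt_sq hs0.le]
  nlinarith

theorem sum_step_sq_le {γ t G : ℝ} (ht : 1 ≤ t) (hG : 0 ≤ G) (n : ℕ) :
    ∑ i ∈ Finset.range n, (γ / (i + t)) ^ 2 * G ≤ 2 * γ ^ 2 * G / t := by
  have h : ∑ i ∈ Finset.range n, 1 / ((i : ℝ) + t) ^ 2 ≤ 2 / t - 2 / (n + t) := by
    induction n with
    | zero => simp
    | succ n ih =>
      rw [Finset.sum_range_succ]
      have hs : (1 : ℝ) ≤ n + t := by
        have : (0 : ℝ) ≤ n := Nat.cast_nonneg n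
        linarith
      -- A telescoping majorant, valid because `s + 1 ≤ 2s` for `s ≥ 1`.
      have h1 : 1 / ((n : ℝ) + t) ^ 2 ≤ 2 / (n + t) - 2 / (n + t + 1) := by
        rw [div_sub_div _ _ (by linarith) (by linarith),
          div_le_div_iff₀ (by positivity) (by positivity)]
        nlinarith [mul_nonneg (by linarith : (0 : ℝ) ≤ n + t - 1) (by linarith : (0 : ℝ) ≤ n + t)]
      push_cast
      rw [add_right_comm (n : ℝ) 1 t]
      linarith
  have hn : 0 ≤ 2 / ((n : ℝ) + t) := by positivity
  calc ∑ i ∈ Finset.range n, (γ / (i + t)) ^ 2 * G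
      = γ ^ 2 * G * ∑ i ∈ Finset.range n, 1 / ((i : ℝ) + t) ^ 2 := by
        rw [Finset.mul_sum]
        refine Finset.sum_congr rfl fun i _ => ?_
        rw [div_pow]
        field_simp
    _ ≤ γ ^ 2 * G * (2 / t) :=
        mul_le_mul_of_nonneg_left (by linarith) (by positivity)
    _ = 2 * γ ^ 2 * G / t := by ring

end Constants

/-! ### Conclusions for a process that stays in the ball -/

section Conditional

variable {d : ℕ} {Ω : Type*} [MeasurableSpace Ω] {P : Measure Ω}
  {x : ℕ → Ω → Vec d}

theorem one_sub_le_measureReal_stay [IsProbabilityMeasure P] {U : Set (Vec d)}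
    (hE : ∀ n, MeasurableSet (stayUpTo x U n)) {c K : ℝ} (hc : 0 < c) (hK : 0 ≤ K)
    (h : ∀ n, ENNReal.ofReal c * P (stayUpTo x U n)ᶜ ≤ ENNReal.ofReal K) :
    1 - K / c ≤ P.real {ω | ∀ n, x n ω ∈ U} := by
  have hn : ∀ n, P (stayUpTo x U n)ᶜ ≤ ENNReal.ofReal (K / c) := by
    intro n
    rw [ENNReal.ofReal_div_of_pos hc]
    refine (ENNReal.le_div_iff_mul_le (Or.inl (ENNReal.ofReal_pos.2 hc).ne')
      (Or.inl ENNReal.ofReal_ne_top)).2 ?_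
    rw [mul_comm]
    exact h n
  have hm : Monotone fun n => (stayUpTo x U n)ᶜ := fun i j hij =>
    Set.compl_subset_compl.2 (antitone_stayUpTo x U hij)
  have hcompl : P {ω | ∀ n, x n ω ∈ U}ᶜ ≤ ENNReal.ofReal (K / c) := by
    rw [← iInter_stayUpTo, Set.compl_iInter, hm.measure_iUnion]
    exact iSup_le hn
  have hEm : MeasurableSet {ω | ∀ n, x n ω ∈ U} := by
    rw [← iInter_stayUpTo]
    exact MeasurableSet.iInter hE
  have h1 := ENNReal.toReal_le_of_le_ofReal (by positivity) hcompl
  have h2 := probReal_compl_eq_one_sub (μ := P) hEm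
  rw [measureReal_def] at h2
  linarith

/-- On an event where the mean squared distance tends to zero, the process comes arbitrarily
close to `c`. -/
theorem ae_exists_norm_sub_lt {c : Vec d} {E : Set Ω} (hE : MeasurableSet E)
    (hx : ∀ n, Measurable (x n)) {b : ℕ → ENNReal} (hb : Tendsto b atTop (𝓝 0))
    (h : ∀ n, ∫⁻ ω in E, ENNReal.ofReal (‖x n ω - c‖ ^ 2) ∂P ≤ b n) :
    ∀ᵐ ω ∂P, ω ∈ E → ∀ η > 0, ∃ n, ‖x n ω - c‖ ^ 2 < η := by
  have hj : ∀ j : ℕ, ∀ᵐ ω ∂P, ω ∈ E → ∃ n, ‖x n ω - c‖ ^ 2 < 1 / ((j : ℝ) + 1) := by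
    intro j
    set η : ℝ := 1 / ((j : ℝ) + 1) with hη
    have hη0 : 0 < η := Nat.one_div_pos_of_nat
    set N : Set Ω := E ∩ {ω | ∀ n, η ≤ ‖x n ω - c‖ ^ 2} with hN
    have hNm : MeasurableSet N := by
      refine hE.inter ?_
      rw [Set.ofPred_forall]
      exact MeasurableSet.iInter fun n => measurableSet_le measurable_const
        (((hx n).sub_const c).norm.pow_const 2)
    have hle : ∀ n, ENNReal.ofReal η * P N ≤ b n := fun n =>
      calc ENNReal.ofReal η * P N = ∫⁻ ω in N, ENNReal.ofReal η ∂P := (setLIntegral_const _ _).symm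
        _ ≤ ∫⁻ ω in N, ENNReal.ofReal (‖x n ω - c‖ ^ 2) ∂P :=
            setLIntegral_mono' hNm fun ω hω => ENNReal.ofReal_le_ofReal (hω.2 n)
        _ ≤ ∫⁻ ω in E, ENNReal.ofReal (‖x n ω - c‖ ^ 2) ∂P :=
            lintegral_mono_set Set.inter_subset_left
        _ ≤ b n := h n
    have h0 : ENNReal.ofReal η * P N = 0 := le_antisymm (ge_of_tendsto' hb hle) zero_le
    have hN0 : P N = 0 := by
      rcases mul_eq_zero.1 h0 with h | h
      · exact absurd h (ENNReal.ofReal_pos.2 hη0).ne'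
      · exact h
    filter_upwards [measure_eq_zero_iff_ae_notMem.1 hN0] with ω hω hωE
    by_contra! hne
    exact hω ⟨hωE, hne⟩
  filter_upwards [ae_all_iff.2 hj] with ω hω hωE η hη
  obtain ⟨j, hj⟩ := exists_nat_one_div_lt hη
  obtain ⟨n, hn⟩ := hω j hωE
  exact ⟨n, hn.trans hj⟩

theorem integrable_cond_and_integral_le {E : Set Ω} {φ : Ω → ℝ}
    (hφ : Measurable φ) (hφ0 : ∀ ω, 0 ≤ φ ω) {K q : ℝ} (hK : 0 ≤ K) (hq : 0 < q)
    (hPE : q ≤ P.real E) (h : ∫⁻ ω in E, ENNReal.ofReal (φ ω) ∂P ≤ ENNReal.ofReal K) :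
    Integrable φ P[|E] ∧ ∫ ω, φ ω ∂P[|E] ≤ K / q := by
  have hint : Integrable φ (P.restrict E) := by
    refine ⟨hφ.aestronglyMeasurable, ?_⟩
    rw [hasFiniteIntegral_iff_ofReal (Eventually.of_forall hφ0)]
    exact h.trans_lt ENNReal.ofReal_lt_top
  have hPE0 : P E ≠ 0 := by
    intro h0
    rw [measureReal_def, h0, ENNReal.toReal_zero] at hPE
    linarith
  refine ⟨hint.smul_measure (ENNReal.inv_ne_top.2 hPE0), ?_⟩
  rw [ProbabilityTheory.cond, integral_smul_measure, ENNReal.toReal_inv, ← measureReal_def,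
    integral_eq_lintegral_of_nonneg_ae (Eventually.of_forall hφ0) hφ.aestronglyMeasurable,
    smul_eq_mul, ← div_eq_inv_mul]
  exact div_le_div₀ hK (ENNReal.toReal_le_of_le_ofReal hK h) hq hPE

end Conditional

/-! ### The saddle search as a reflected descent. -/

namespace SaddleSearch

variable {d k : ℕ} {S : Type*}

theorem subOrthonormal_run (a : SaddleSearch d S) (x₀ : Vec d) {v₀ : Fin k → Vec d}
    (hv₀ : Orthonormal ℝ v₀) (z : SampleIdx k → S) (n : ℕ) :
    SubOrthonormal Finset.univ (a.run x₀ v₀ z n).2 := by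
  cases n with
  | zero => exact hv₀.subOrthonormal _
  | succ n => exact subOrthonormal_eigenSearch _ _ _ _ _

theorem reflectedDescent_run {Ω : Type*} [MeasurableSpace Ω] [MeasurableSpace S] {P : Measure Ω} {ν : Measure S}
    (a : SaddleSearch d S) (x₀ : Vec d) {v₀ : Fin k → Vec d} (hv₀ : Orthonormal ℝ v₀)
    {Z : SampleIdx k → Ω → S} (hind : iIndepFun Z P) (hZ : ∀ i, MeasurePreserving (Z i) P ν)
    (hg : Measurable (Function.uncurry a.g)) (hh : Measurable (Function.uncurry a.h))
    (hH : Measurable (hessian a.f)) :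
    ReflectedDescent P ν a.g a.α (fun n => sampleSigma Z (outerPast k n))
      (fun n => Z (Sum.inl n)) (fun n ω => (a.run x₀ v₀ (fun i => Z i ω) n).1)
      (fun n ω => (a.run x₀ v₀ (fun i => Z i ω) n).2) := by
  have hZm : ∀ i, Measurable (Z i) := fun i => (hZ i).measurable
  have hrun : ∀ n, Measurable[sampleSigma Z (outerPast k n)]
      fun ω => a.run x₀ v₀ (fun i => Z i ω) n := fun n =>
    @measurable_run d k S _ Ω (sampleSigma Z (outerPast k n)) a x₀ v₀ hg hh hH Z n
      fun i hi => measurable_sampleSigma hi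
  refine ⟨fun n => sampleSigma_le hZm _, fun n n' hn => ?_, fun n => hZ _,
    fun n => indep_sampleSigma hZm hind (by simp [outerPast]),
    fun n => _root_.measurable_fst.comp (hrun n), fun n => _root_.measurable_snd.comp (hrun n),
    fun n ω => subOrthonormal_run a x₀ hv₀ _ n, fun n ω => rfl⟩
  refine biSup_mono fun i hi => ?_
  rcases i with i | q
  · exact lt_of_lt_of_le (show i < n from hi) hn
  · exact lt_of_lt_of_le (show q.1 < n from hi) hn

/-- The descent inequality at a point where the search has found unstable directions. -/
theorem le_inner_reflect_run (a : SaddleSearch d S) (x₀ : Vec d) (v₀ : Fin k → Vec d)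
    (z : SampleIdx k → S) (hf : ContDiff ℝ 3 a.f) {xs : Vec d} (hxs : gradient a.f xs = 0)
    {δ L μ M θ : ℝ} (hH : HessianAssumption a.f xs k δ L μ M) (hkd : k ≤ d) (hδ : 0 ≤ δ)
    (hμ : 0 < μ) (hL : 0 ≤ L) (hM : 0 < M) (hθ : k ^ 2 * a.tol / μ ^ 2 ≤ θ) {n : ℕ}
    (hst : a.StopsAt x₀ v₀ z n)
    (hunst : ∀ i, inner ℝ ((a.run x₀ v₀ z (n + 1)).2 i)
      (hessian a.f (a.run x₀ v₀ z (n + 1)).1 ((a.run x₀ v₀ z (n + 1)).2 i)) < 0)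
    (hx : (a.run x₀ v₀ z (n + 1)).1 ∈ Metric.closedBall xs (attractionRadius L μ M δ θ)) :
    (μ - 4 * L * √θ - descentConst L μ θ) * ‖(a.run x₀ v₀ z (n + 1)).1 - xs‖ ^ 2 ≤
      inner ℝ ((a.run x₀ v₀ z (n + 1)).1 - xs) (reflect (a.run x₀ v₀ z (n + 1)).2
        (gradient a.f (a.run x₀ v₀ z (n + 1)).1)) := by
  have hsub : SubOrthonormal Finset.univ (a.run x₀ v₀ z (n + 1)).2 :=
    subOrthonormal_eigenSearch _ _ _ _ _
  have hfield : ∀ j, ‖searchField (hessian a.f (a.run x₀ v₀ z (n + 1)).1)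
      (a.run x₀ v₀ z (n + 1)).2 j ((a.run x₀ v₀ z (n + 1)).2 j)‖ ^ 2 < a.tol :=
    fun j => SearchStops.norm_searchField_eigenSearch hst j
  set p := a.run x₀ v₀ z (n + 1) with hp
  -- The strict inequality `vᵀHv < 0` rules out the degenerate value `v = 0`.
  have horth : Orthonormal ℝ p.2 := by
    refine ⟨fun i => ?_, fun i j hij => hsub.orth i (Finset.mem_univ i) j (Finset.mem_univ j) hij⟩
    rcases hsub.norm i (Finset.mem_univ i) with h | h
    · have := hunst i
      rw [h, inner_zero_left] at this
      exact absurd this (lt_irrefl 0)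
    · exact h
  have hxδ : p.1 ∈ Metric.closedBall xs δ := Metric.closedBall_subset_closedBall (min_le_right _ _) hx
  have hxc : ‖p.1 - xs‖ ≤ descentConst L μ θ / M := by
    rw [← dist_eq_norm]
    exact (Metric.mem_closedBall.1 hx).trans (min_le_left _ _)
  exact le_inner_reflect_gradient hf hxs hH hM hδ hxδ hsub hxc
    ((hH.gap _ hxδ).le_inner_reflect hkd hμ hL horth (fun j => (hfield j).le) hunst hθ _)

end SaddleSearch

/-! ### Choice of the constants and conclusion. -/

theorem mainTheorem1 {d k : ℕ} (hk : 1 ≤ k) (hkd : k < d)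
    (f : Vec d → ℝ) (hf : ContDiff ℝ 3 f) (xs : Vec d) (hxs : gradient f xs = 0)
    (δ L μ M σ G₁ : ℝ) (hδ : 0 < δ) (hμ : 0 < μ) (hμL : μ < L) (hM : 0 < M)
    (hH : HessianAssumption f xs k δ L μ M)
    (Δ : ENNReal) (hΔ : Δ = negGap f xs δ)
    (εv : ℝ) (hεv : 0 < εv)
    (z : ℝ) (hz : z = zbar d k L (constQ Δ L μ) εv)
    (hsmall : ENNReal.ofReal z < min (Δ / 2) (ENNReal.ofReal μ))
    (θ : ℝ) (hθ : θ = k * z ^ 2 * d)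
    (hθpos : 0 < descentConst L μ θ)
    (U : Set (Vec d)) (hU : U = Metric.closedBall xs (attractionRadius L μ M δ θ)) :
    ∃ (ε : ℝ) (U₀ : Set (Vec d)), 0 < ε ∧
      4 * ε + 2 * √ε = attractionRadius L μ M δ θ ^ 2 ∧
      U₀ = Metric.closedBall xs (√(2 * ε)) ∧ U₀.Nonempty ∧ U₀ ⊆ U ∧
      ∃ γ₀ : ℝ, 0 < γ₀ ∧ ∀ γ ≥ γ₀, ∃ (m₀ : ℝ) (p C : ℝ → ℝ), 0 < m₀ ∧
        Tendsto p atTop (𝓝 0) ∧ (∀ m ≥ m₀, p m < 1) ∧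
        ∀ m ≥ m₀,
          -- stochastic gradient and stochastic Hessian
          ∀ (S : Type*) [MeasurableSpace S] (ν : Measure S) [IsProbabilityMeasure ν]
            (g : Vec d → S → Vec d) (h : Vec d → S → Vec d →L[ℝ] Vec d),
            UnbiasedGradient f g ν σ →
            UnbiasedHessian f h ν σ G₁ (Metric.closedBall xs δ) →
          -- independent samples
          ∀ (Ω : Type*) [MeasurableSpace Ω] (P : Measure Ω) [IsProbabilityMeasure P]
            (Z : SampleIdx k → Ω → S),
            iIndepFun Z P → (∀ i, MeasurePreserving (Z i) P ν) →
          -- step sizes of the eigenvector search, and the initial values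
          ∀ (β : ℕ → ℝ), DecayStepSize β →
          ∀ x₀ ∈ U₀, ∀ v₀ : Fin k → Vec d, Orthonormal ℝ v₀ →
          ∀ (a : SaddleSearch d S),
            a = { f := f, g := g, h := h, tol := L ^ 2 * εv,
                  α := fun n => γ / (n + m), β := β } →
            (∀ᵐ ω ∂P, a.FindsUnstable x₀ v₀ (fun i => Z i ω) U) →
          ∀ (x : ℕ → Ω → Vec d), (x = fun n ω => (a.run x₀ v₀ (fun i => Z i ω) n).1) →
          ∀ (E : Set Ω), E = {ω | ∀ n, x n ω ∈ U} →
            1 - p m ≤ P.real E ∧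
            (∀ᵐ ω ∂P[|E], ∀ n, a.StopsAt x₀ v₀ (fun i => Z i ω) n) ∧
            (∀ᵐ ω ∂P[|E], ∀ εx > 0, ∃ n, ‖gradient f (x n ω)‖ ^ 2 < L ^ 2 * εx) ∧
            ∀ n : ℕ, Integrable (fun ω => ‖x n ω - xs‖ ^ 2) P[|E] ∧
              ∫ ω, ‖x n ω - xs‖ ^ 2 ∂P[|E] ≤ C m / (n + m) := by
  have hd : 0 < d := by omega
  have hL : 0 < L := hμ.trans hμL
  have hΔ0 : Δ ≠ 0 := by
    rintro rfl
    simp at hsmall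
  obtain ⟨hθ0, hθtol⟩ : 0 < θ ∧ (k : ℝ) ^ 2 * (L ^ 2 * εv) / μ ^ 2 ≤ θ := by
    rw [hθ, hz]
    exact theta_bounds hk hd hΔ0 hL hμ hεv
  set r := attractionRadius L μ M δ θ with hr
  have hr0 : 0 < r := lt_min (div_pos hθpos hM) hδ
  obtain ⟨ε, hε, hεr, hρr⟩ := exists_radius hr0
  set ρ := √(2 * ε) with hρ
  have hρ0 : 0 ≤ ρ := Real.sqrt_nonneg _
  set κ := μ - 4 * L * √θ - descentConst L μ θ with hκ
  -- The term `5L√θ` in `c(θ)` exceeds the `4L√θ` lost to the approximate frame; the surplus,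
  -- together with `μ√θ + Lθ`, is the contraction constant.
  have hκ0 : 0 < κ := by
    have : κ = μ * √θ + L * θ + L * √θ := by
      rw [hκ, descentConst]
      ring
    rw [this]
    positivity
  set G := L ^ 2 * r ^ 2 + σ ^ 2 with hG
  have hG0 : 0 ≤ G := by positivity
  have hUδ : Metric.closedBall xs r ⊆ Metric.closedBall xs δ :=
    Metric.closedBall_subset_closedBall (min_le_right _ _)
  have hgradU : ∀ y ∈ Metric.closedBall xs r, ‖gradient f y‖ ≤ L * ‖y - xs‖ := fun y hy =>
    norm_gradient_le hf hxs hH hL.le hδ.le (hUδ hy)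
  have hGU : ∀ y ∈ Metric.closedBall xs r, ‖gradient f y‖ ^ 2 + σ ^ 2 ≤ G := by
    intro y hy
    have h1 : ‖y - xs‖ ≤ r := by simpa [dist_eq_norm] using hy
    have h2 : ‖gradient f y‖ ≤ L * r :=
      (hgradU y hy).trans (mul_le_mul_of_nonneg_left h1 hL.le)
    have h3 := pow_le_pow_left₀ (norm_nonneg _) h2 2
    rw [mul_pow] at h3
    rw [hG]
    linarith
  have hrρ : 0 < (r - ρ) ^ 2 := pow_pos (sub_pos.2 hρr) 2
  -- `γ₀ = 1 / κ` ensures `2κγ ≥ 2`, the threshold above which the recursion has rate `1/(n+m)`.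
  refine ⟨ε, Metric.closedBall xs ρ, hε, hεr, rfl, ⟨xs, Metric.mem_closedBall_self hρ0⟩, ?_,
    1 / κ, by positivity, fun γ hγ => ?_⟩
  · rw [hU]
    exact Metric.closedBall_subset_closedBall hρr.le
  have hγ0 : 0 < γ := lt_of_lt_of_le (by positivity) hγ
  have hγκ : 1 ≤ κ * γ := by
    rw [ge_iff_le, div_le_iff₀ hκ0] at hγ
    linarith
  -- The total noise is at most `2γ²G/m`; divided by the cost `(r - ρ)²` of leaving, it gives `p(m)
  -- = a₀/m`.
  set a₀ := 2 * γ ^ 2 * G / (r - ρ) ^ 2 with ha₀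
  have ha₀0 : 0 ≤ a₀ := by positivity
  -- The summands of `m₀` yield, in turn, the telescoping bound, nonnegative contraction factors `1
  -- - 2κγ/(n+m)`, and `p(m) < 1`. The denominator of `C` is the lower bound for `P(E^∞)`.
  refine ⟨1 + 2 * κ * γ + a₀, fun m => a₀ / m,
    fun m => (r ^ 2 * (1 + m) + γ ^ 2 * G) / (1 - a₀ / m), by positivity,
    tendsto_const_nhds.div_atTop tendsto_id, fun m hm => ?_, ?_⟩
  · have hm0 : 0 < m := lt_of_lt_of_le (by positivity) hm
    rw [div_lt_one hm0]
    nlinarith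
  intro m hm S _ ν _ g h hg hh Ω _ P _ Z hind hZ β hβ x₀ hx₀ v₀ hv₀ a ha hunst x hx E hE
  have hm1 : 1 ≤ m := by nlinarith
  have hm0 : 0 < m := by linarith
  have hmκ : 2 * κ * γ ≤ m := by linarith
  have hp : 0 < 1 - a₀ / m := by
    rw [sub_pos, div_lt_one hm0]
    nlinarith
  have haf : a.f = f := by rw [ha]
  have hag : a.g = g := by rw [ha]
  have hah : a.h = h := by rw [ha]
  have hatol : a.tol = L ^ 2 * εv := by rw [ha]
  have haα : ∀ n : ℕ, a.α n = γ / (n + m) := fun n => by rw [ha]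
  have haβ : a.β = β := by rw [ha]
  have hHm : Measurable (hessian a.f) := by
    rw [haf]
    exact (continuous_hessian hf).measurable
  have hdescent : ReflectedDescent P ν g a.α
      (fun n => sampleSigma Z (SaddleSearch.outerPast k n)) (fun n => Z (Sum.inl n)) x
      (fun n ω => (a.run x₀ v₀ (fun i => Z i ω) n).2) := by
    rw [hx, ← hag]
    exact a.reflectedDescent_run x₀ hv₀ hind hZ (by rw [hag]; exact hg.measurable)
      (by rw [hah]; exact hh.measurable) hHm
  have hstops : ∀ᵐ ω ∂P, ∀ n, x (n + 1) ω ∈ Metric.closedBall xs r →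
      a.StopsAt x₀ v₀ (fun i => Z i ω) n := by
    refine ae_all_iff.2 fun n => ?_
    have := a.ae_stopsAt x₀ v₀ hind hZ (by rw [hag]; exact hg.measurable)
      Metric.isClosed_closedBall.measurableSet (by rw [haf, hah]; exact hh)
      (by rw [haf]; exact hH.gap) hHm hL.le (by rw [hatol]; positivity) (by rwa [haβ]) n
    filter_upwards [this] with ω hω hωU
    rw [hx] at hωU
    exact hω (hUδ hωU)
  have hdesc : ∀ᵐ ω ∂P, ∀ n, n ≠ 0 → ω ∈ stayUpTo x (Metric.closedBall xs r) n →
      κ * ‖x n ω - xs‖ ^ 2 ≤ inner ℝ (x n ω - xs)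
        (SaddleSearch.reflect (a.run x₀ v₀ (fun i => Z i ω) n).2 (gradient f (x n ω))) := by
    filter_upwards [hstops, hunst] with ω hω hω' n hn hωE
    obtain ⟨n, rfl⟩ := Nat.exists_eq_succ_of_ne_zero hn
    have hωn := hωE (n + 1) le_rfl
    have hst := hω n hωn
    subst hx
    rw [← haf]
    exact a.le_inner_reflect_run x₀ v₀ (fun i => Z i ω) (by rwa [haf]) (by rwa [haf])
      (by rwa [haf]) hkd.le hδ.le hμ hL.le hM (by rwa [hatol]) hst
      (hω' n (by rw [hU]; exact hωn) hst) hωn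
  have hx₀' : ∀ ω, ‖x 0 ω - xs‖ ≤ ρ := fun ω => by
    rw [hx, ← dist_eq_norm]
    exact hx₀
  have hEm' : ∀ n, MeasurableSet (stayUpTo x (Metric.closedBall xs r) n) := fun n =>
    hdescent.le n _
      (hdescent.measurableSet_stayUpTo Metric.isClosed_closedBall.measurableSet n)
  have hEeq : E = ⋂ n, stayUpTo x (Metric.closedBall xs r) n := by
    rw [iInter_stayUpTo, hE, hU]
  have hEm : MeasurableSet E := by
    rw [hEeq]
    exact MeasurableSet.iInter hEm'
  have hPE : 1 - a₀ / m ≤ P.real E := by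
    have h1 := one_sub_le_measureReal_stay (P := P) hEm' hrρ
      (by positivity : 0 ≤ 2 * γ ^ 2 * G / m) fun n => by
        refine le_trans le_self_add ((hdescent.measure_compl_stayUpTo_le hg hρ0 hρr.le
          (fun n => by rw [haα]; positivity) hx₀' hGU ?_ n).trans (ENNReal.ofReal_le_ofReal ?_))
        · filter_upwards [hdesc] with ω hω n hn hωE
          exact le_trans (by positivity) (hω n hn hωE)
        · simp only [haα]
          exact sum_step_sq_le hm1 hG0 n
    rw [hE, hU]
    refine le_trans (le_of_eq ?_) h1
    rw [ha₀, div_right_comm]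
  set K := r ^ 2 * (1 + m) + γ ^ 2 * G with hK
  have hK0 : 0 ≤ K := by positivity
  -- `E` lies in every event of staying up to time `n`, so the bound passes to `E` by monotonicity.
  have hrate : ∀ n : ℕ, ∫⁻ ω in E, ENNReal.ofReal (‖x n ω - xs‖ ^ 2) ∂P ≤
      ENNReal.ofReal (K / (n + m)) := fun n => by
    refine le_trans (lintegral_mono_set ?_) (hdescent.setLIntegral_sq_le hg hr0.le haα hγ0.le hm1
      (by linarith) hmκ (by rw [hK]; linarith [mul_nonneg (sq_nonneg γ) hG0])
      (by rw [hK]; linarith [(by positivity : 0 ≤ r ^ 2 * (1 + m))]) hGU hdesc n)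
    rw [hEeq]
    exact Set.iInter_subset _ n
  have hac : P[|E] ≪ P := ProbabilityTheory.cond_absolutelyContinuous
  have hmemU : ∀ᵐ ω ∂P[|E], ∀ n, x n ω ∈ Metric.closedBall xs r := by
    refine ae_cond_of_forall_mem hEm fun ω hω => ?_
    rwa [hE, hU] at hω
  refine ⟨hPE, ?_, ?_, fun n => ?_⟩
  · filter_upwards [hac.ae_le hstops, hmemU] with ω hω hωU n using hω n (hωU (n + 1))
  · have hb : Tendsto (fun n : ℕ => ENNReal.ofReal (K / (n + m))) atTop (𝓝 0) := by
      rw [← ENNReal.ofReal_zero]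
      refine ENNReal.tendsto_ofReal (tendsto_const_nhds.div_atTop ?_)
      exact tendsto_atTop_add_const_right _ m tendsto_natCast_atTop_atTop
    have hclose := ae_exists_norm_sub_lt hEm hdescent.measurable hb hrate
    filter_upwards [hac.ae_le hclose, hmemU, ae_cond_mem hEm] with ω hω hωU hωE εx hεx
    obtain ⟨n, hn⟩ := hω hωE εx hεx
    refine ⟨n, ?_⟩
    calc ‖gradient f (x n ω)‖ ^ 2 ≤ (L * ‖x n ω - xs‖) ^ 2 :=
          pow_le_pow_left₀ (norm_nonneg _) (hgradU _ (hωU n)) 2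
      _ = L ^ 2 * ‖x n ω - xs‖ ^ 2 := mul_pow _ _ _
      _ < L ^ 2 * εx := mul_lt_mul_of_pos_left hn (by positivity)
  · have hxm := hdescent.measurable n
    have h1 := integrable_cond_and_integral_le (P := P) (E := E)
      (φ := fun ω => ‖x n ω - xs‖ ^ 2) (by fun_prop) (fun ω => sq_nonneg _)
      (by positivity : 0 ≤ K / (n + m)) hp hPE (hrate n)
    refine ⟨h1.1, h1.2.trans (le_of_eq ?_)⟩
    rw [div_right_comm]
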